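/- **Notation.** Let $F$ be a probability distribution on a set $\mathcal X\subset\mathbb R^d$ such that $\langle x,x'\rangle\in[0,1]$ for all $x,x'\in\mathcal X$. A pair $(X,A)\sim\mathrm{RDPG}(F)$ on $n$ vertices is a *random dot product graph* if $X=[X_1,\dots,X_n]^\top\in\mathbb R^{n\times d}$ with $X_1,\dots,X_n$ i.i.d. $\sim F$, and $A\in\{0,1\}^{n\times n}$ is a random symmetric matrix with zero diagonal such that $$\mathbb P[A\mid X]=\prod_{i>j}(X_i^\top X_j)^{A_{ij}}(1-X_i^\top X_j)^{1-A_{ij}}.$$ An *adjacency spectral embedding* of $A$ into $\mathbb R^d$ ($d\le n$) is a matrix $\hat X=U_AS_A^{1/2}\in\mathbb R^{n\times d}$, where $|A|=(A^\top A)^{1/2}=[U_A|\tilde U_A][S_A\oplus\tilde S_A][U_A|\tilde U_A]^\top$ is a spectral decomposition with orthogonal $[U_A|\tilde U_A]$, and $S_A$ is the diagonal matrix of the $d$ largest eigenvalues of $|A|$ in decreasing order. For $M\in\mathbb R^{n\times d}$, $\|M\|_{2\to\infty}$ is the largest Euclidean norm of a row of $M$. A sequence of events $E_n$ *occurs asymptotically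 almost surely* if for every $c>0$ there is $n_0(c)$ such that $\mathbb P(E_n)\ge 1-\eta$ whenever $n>n_0(c)$ and $n^{-c}<\eta<1/2$. **Theorem 1.** There is a constant $C>0$ with the following property. Let $d$ and $F$ be as above and suppose that the second moment matrix $\Delta=\mathbb E[X_1X_1^\top]$, $X_1\sim F$, has rank $d$ (its eigenvalues need not be distinct). For each $n$ let $(X,A)\sim\mathrm{RDPG}(F)$ on $n$ vertices, and let $E_n$ be the event that for every adjacency spectral embedding $\hat X$ of $A$ into $\mathbb R^d$ there is an orthogonal matrix $W\in\mathbb R^{d\times d}$ with $$\|\hat X-XW\|_{2\to\infty}=\max_{1\le i\le n}\|\hat X_i-W^\top X_i\|\le\frac{C\,d^{1/2}\log^2 n}{\sqrt n},$$ where $X_i$, $\hat X_i$ are the rows of $X$, $\hat X$ written as column vectors. Then $E_n$ occurs asymptotically almost surely ($n_0(c)$ may depend on $F$). -/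

import Mathlib

open MeasureTheory ProbabilityTheory
open scoped Matrix RealInnerProductSpace

/-- `F` is a probability distribution on (i.e. carried by) a set `𝒳 ⊆ ℝ^d` all of whose pairwise
inner products lie in `[0,1]`. -/
def IsLatentDistribution {d : ℕ} (F : Measure (EuclideanSpace ℝ (Fin d))) : Prop :=
  IsProbabilityMeasure F ∧
    ∃ 𝒳 : Set (EuclideanSpace ℝ (Fin d)),
      (∀ x ∈ 𝒳, ∀ y ∈ 𝒳, ⟪x, y⟫ ∈ Set.Icc (0 : ℝ) 1) ∧ ∀ᵐ x ∂F, x ∈ 𝒳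

/-- The second moment matrix `Δ = E[X₁ X₁ᵀ]` of a random vector `X₁ ∼ F`. -/
noncomputable def secondMoment {d : ℕ} (F : Measure (EuclideanSpace ℝ (Fin d))) :
    Matrix (Fin d) (Fin d) ℝ :=
  Matrix.of fun k l => ∫ x, x k * x l ∂F

/-- `(X, A) ∼ RDPG(F)` on `n` vertices: the latent positions `X₁, …, Xₙ` are i.i.d. with law `F`,
`A` is a random symmetric hollow `0/1` matrix, and conditionally on `X` the probability of `A = a`
is the product over `i > j` of `⟨Xᵢ, Xⱼ⟩` (if `aᵢⱼ = 1`) or `1 - ⟨Xᵢ, Xⱼ⟩` (if `aᵢⱼ = 0`). -/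
structure IsRDPG {d n : ℕ} {Ω : Type*} [MeasurableSpace Ω]
    (F : Measure (EuclideanSpace ℝ (Fin d))) (μ : Measure Ω)
    (X : Fin n → Ω → EuclideanSpace ℝ (Fin d)) (A : Ω → Matrix (Fin n) (Fin n) ℝ) : Prop where
  measurable_position : ∀ i, Measurable (X i)
  map_position : ∀ i, μ.map (X i) = F
  indep : iIndepFun X μ
  measurable_entry : ∀ i j, Measurable fun ω => A ω i j
  isAdjMatrix : ∀ ω, (A ω).IsAdjMatrix
  condProb_eq : ∀ a : Matrix (Fin n) (Fin n) ℝ, a.IsAdjMatrix →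
    μ⟦{ω | A ω = a} | MeasurableSpace.comap (fun ω i => X i ω) inferInstance⟧ =ᵐ[μ]
      fun ω => ∏ i, ∏ j ∈ Finset.Iio i,
        if a i j = 1 then ⟪X i ω, X j ω⟫ else 1 - ⟪X i ω, X j ω⟫

/-- The `n × d` matrix whose rows are the latent positions. -/
def positionMatrix {d n : ℕ} {Ω : Type*} (X : Fin n → Ω → EuclideanSpace ℝ (Fin d)) (ω : Ω) :
    Matrix (Fin n) (Fin d) ℝ :=
  Matrix.of fun i k => X i ω k

open scoped MatrixOrder in
/-- `|A| = (Aᵀ A)^{1/2}`, the positive semidefinite square root. -/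
noncomputable def matrixAbs {n : ℕ} (A : Matrix (Fin n) (Fin n) ℝ) : Matrix (Fin n) (Fin n) ℝ :=
  CFC.sqrt (Aᵀ * A)

/-- `Xhat` is an adjacency spectral embedding of `A` into `ℝ^d`: there is a spectral decomposition
`|A| = V diag(s) Vᵀ` with `V` orthogonal and `s₁ ≥ s₂ ≥ ⋯ ≥ sₙ` such that
`Xhat = U_A S_A^{1/2}`, where `U_A` consists of the first `d` columns of `V` and
`S_A = diag(s₁, …, s_d)`. (Eigenvectors are not unique, hence a predicate.) -/
def IsASE {n : ℕ} (d : ℕ) (A : Matrix (Fin n) (Fin n) ℝ) (Xhat : Matrix (Fin n) (Fin d) ℝ) :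
    Prop :=
  ∃ (h : d ≤ n) (V : Matrix (Fin n) (Fin n) ℝ) (s : Fin n → ℝ),
    V ∈ Matrix.orthogonalGroup (Fin n) ℝ ∧ Antitone s ∧
      matrixAbs A = V * Matrix.diagonal s * Vᵀ ∧
      Xhat = V.submatrix id (Fin.castLE h) * Matrix.diagonal fun k => √(s (Fin.castLE h k))

/-- The `2 → ∞` norm: the largest Euclidean norm of a row. -/
noncomputable def twoToInftyNorm {n d : ℕ} (M : Matrix (Fin n) (Fin d) ℝ) : ℝ :=
  ⨆ i, ‖WithLp.toLp 2 (M i)‖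

/-- The events `E n` occur asymptotically almost surely: for every `c > 0` there is `n₀` such that
`P(E n) ≥ 1 - η` whenever `n > n₀` and `n^{-c} < η < 1/2`. -/
def OccursAAS {Ω : ℕ → Type*} [∀ n, MeasurableSpace (Ω n)] (μ : ∀ n, Measure (Ω n))
    (E : ∀ n, Set (Ω n)) : Prop :=
  ∀ c : ℝ, 0 < c → ∃ n₀ : ℕ, ∀ n : ℕ, n₀ < n → ∀ η : ℝ,
    (n : ℝ) ^ (-c) < η → η < 1 / 2 → 1 - η ≤ (μ n).real (E n)

/-!
Write `Δ` for the second moment matrix and `E = A - X Xᵀ`. Conditionally on `X`, and up to the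
diagonal of `E`, Hoeffding's inequality bounds the entries of `E X` and the off-diagonal entries of
`E²` by a `t` of order `√(n log n)`; it also bounds the entries of `Xᵀ X - n Δ`. Hence
`‖E‖² ≲ n t = o(n²)`, while `Xᵀ X` is of order `n` because `Δ` is positive definite. So the top `d`
eigenvalues `S` of `|A|` are of order `n`, and they are eigenvalues of `A` itself: `A U = U S`.

Put `Z = U S^{1/2}` and `Q = U S^{-1/2}`. Then `Z = A Q = X (Xᵀ Q) + E Q`, where `Xᵀ Q` is nearly
orthogonal, and `W` is its polar factor. Since `Q = A Q S⁻¹`, the error is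
`E Q = (E X (Xᵀ Q) + E (E Q)) S⁻¹`: this bounds `‖E Q‖` first, because `‖E‖ ‖S⁻¹‖` is small, and
then every row of `E Q`. No gap between the eigenvalues of `Δ` is needed.
-/

section OperatorNorm

open scoped Matrix.Norms.L2Operator
open WithLp Matrix

variable {l m n : Type*} [Fintype m] [Fintype n]

theorem norm_le_sqrt_card_mul (v : EuclideanSpace ℝ n) {c : ℝ} (hc : 0 ≤ c)
    (hv : ∀ i, ‖v i‖ ≤ c) : ‖v‖ ≤ √(Fintype.card n) * c := by
  rw [EuclideanSpace.norm_eq]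
  refine Real.sqrt_le_iff.2 ⟨by positivity, ?_⟩
  calc ∑ i, ‖v i‖ ^ 2 ≤ ∑ _i : n, c ^ 2 :=
        Finset.sum_le_sum fun i _ => pow_le_pow_left₀ (norm_nonneg _) (hv i) 2
    _ = (√(Fintype.card n) * c) ^ 2 := by
        simp [mul_pow]

omit [Fintype m] in
theorem norm_row_add_le (B C : Matrix m n ℝ) (i : m) :
    ‖toLp 2 ((B + C) i)‖ ≤ ‖toLp 2 (B i)‖ + ‖toLp 2 (C i)‖ :=
  norm_add_le (toLp 2 (B i)) (toLp 2 (C i))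

variable [DecidableEq n]

theorem norm_toEuclideanLin_le (B : Matrix m n ℝ) (v : EuclideanSpace ℝ n) :
    ‖B.toEuclideanLin v‖ ≤ ‖B‖ * ‖v‖ :=
  B.l2_opNorm_mulVec v

theorem l2_opNorm_transpose [DecidableEq m] (B : Matrix m n ℝ) : ‖Bᵀ‖ = ‖B‖ := by
  rw [← conjTranspose_eq_transpose_of_trivial, l2_opNorm_conjTranspose]

theorem l2_opNorm_transpose_mul_self (B : Matrix m n ℝ) : ‖Bᵀ * B‖ = ‖B‖ ^ 2 := by
  rw [← conjTranspose_eq_transpose_of_trivial, l2_opNorm_conjTranspose_mul_self, sq]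

theorem norm_row_mul_le (B : Matrix l m ℝ) (C : Matrix m n ℝ) (i : l) :
    ‖toLp 2 ((B * C) i)‖ ≤ ‖toLp 2 (B i)‖ * ‖C‖ := by
  classical
  have h := norm_toEuclideanLin_le Cᵀ (toLp 2 (B i))
  rwa [l2_opNorm_transpose, toLpLin_toLp, toLin'_apply, mulVec_transpose, ← mul_apply_eq_vecMul,
    mul_comm] at h

theorem l2_opNorm_le_sqrt_card_mul_of_row_le (B : Matrix m n ℝ) {c : ℝ} (hc : 0 ≤ c)
    (hB : ∀ i, ‖toLp 2 (B i)‖ ≤ c) : ‖B‖ ≤ √(Fintype.card m) * c := by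
  rw [l2_opNorm_def]
  refine ContinuousLinearMap.opNorm_le_bound _ (by positivity) fun v => ?_
  rw [mul_assoc]
  refine norm_le_sqrt_card_mul _ (by positivity) fun i => ?_
  calc ‖(B *ᵥ v.ofLp) i‖ = ‖⟪toLp 2 (B i), v⟫‖ := by
        rw [EuclideanSpace.inner_eq_star_dotProduct, mulVec, dotProduct_comm]; rfl
    _ ≤ ‖toLp 2 (B i)‖ * ‖v‖ := norm_inner_le_norm _ _
    _ ≤ c * ‖v‖ := by gcongr; exact hB i

theorem l2_opNorm_le_card_mul_of_entry_le (B : Matrix n n ℝ) {c : ℝ} (hc : 0 ≤ c)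
    (hB : ∀ i j, |B i j| ≤ c) : ‖B‖ ≤ Fintype.card n * c := by
  refine (l2_opNorm_le_sqrt_card_mul_of_row_le B (by positivity) fun i =>
    norm_le_sqrt_card_mul (toLp 2 (B i)) hc (hB i)).trans_eq ?_
  rw [← mul_assoc, Real.mul_self_sqrt (Nat.cast_nonneg _)]

theorem norm_sub_one_le_norm_mul_self_sub_one {R : Matrix n n ℝ} (hR : R.PosSemidef) :
    ‖R - 1‖ ≤ ‖R * R - 1‖ := by
  rw [l2_opNorm_def (R - 1)]
  refine ContinuousLinearMap.opNorm_le_bound _ (norm_nonneg _) fun v => ?_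
  set w := (R - 1).toEuclideanLin v with hw
  have hsplit : (R * R - 1).toEuclideanLin v = R.toEuclideanLin w + w := by
    rw [hw, show R * R - 1 = R * (R - 1) + (R - 1) by noncomm_ring]
    simp
  have hRw : 0 ≤ ⟪R.toEuclideanLin w, w⟫ := by
    simpa using (isPositive_toEuclideanLin_iff.2 hR).2 w
  have hmul : ‖w‖ * ‖w‖ ≤ ‖(R * R - 1).toEuclideanLin v‖ * ‖w‖ := by
    refine le_trans ?_ (real_inner_le_norm _ _)
    rw [hsplit, inner_add_left, real_inner_self_eq_norm_mul_norm]
    linarith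
  have hw' : ‖w‖ ≤ ‖(R * R - 1).toEuclideanLin v‖ := by
    rcases (norm_nonneg w).eq_or_lt with h0 | h0
    · rw [← h0]; exact norm_nonneg _
    · exact le_of_mul_le_mul_right hmul h0
  exact hw'.trans (norm_toEuclideanLin_le _ v)

open scoped MatrixOrder in
theorem exists_mem_orthogonalGroup_norm_sub_le (M : Matrix n n ℝ) (hM : ‖Mᵀ * M - 1‖ < 1) :
    ∃ W ∈ orthogonalGroup n ℝ, ‖M - W‖ ≤ ‖Mᵀ * M - 1‖ := by
  have hMM : 0 ≤ Mᵀ * M := by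
    simpa [nonneg_iff_posSemidef] using posSemidef_conjTranspose_mul_self M
  set R := CFC.sqrt (Mᵀ * M)
  have hR : R.PosSemidef := nonneg_iff_posSemidef.1 (CFC.sqrt_nonneg _)
  have hRR : R * R = Mᵀ * M := CFC.sqrt_mul_sqrt_self _ hMM
  have hdet : IsUnit R.det := by
    have hunit := (Units.oneSub (1 - Mᵀ * M) (by rwa [norm_sub_rev])).isUnit
    rw [Units.val_oneSub, sub_sub_cancel, isUnit_iff_isUnit_det, ← hRR, det_mul] at hunit
    exact isUnit_of_mul_isUnit_left hunit
  have hRt : Rᵀ = R := by simpa [IsSymm] using hR.1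
  -- `M = W * R` is the polar decomposition of `M`.
  set W := M * R⁻¹ with hW
  have hWW : Wᵀ * W = 1 := by
    rw [hW, transpose_mul, transpose_nonsing_inv, hRt, Matrix.mul_assoc, ← Matrix.mul_assoc Mᵀ,
      ← hRR, Matrix.mul_assoc R, mul_nonsing_inv _ hdet, Matrix.mul_one, nonsing_inv_mul _ hdet]
  have hWmem : W ∈ orthogonalGroup n ℝ := (mem_orthogonalGroup_iff' n ℝ).2 hWW
  refine ⟨W, hWmem, ?_⟩
  calc ‖M - W‖ = ‖W * (R - 1)‖ := by
        rw [Matrix.mul_sub, hW, Matrix.mul_assoc, nonsing_inv_mul _ hdet, Matrix.mul_one,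
          Matrix.mul_one]
    _ = ‖R - 1‖ := CStarRing.norm_mem_unitary_mul _ hWmem
    _ ≤ ‖Mᵀ * M - 1‖ := hRR ▸ norm_sub_one_le_norm_mul_self_sub_one hR

end OperatorNorm

section Eigenvalues

variable {E F : Type*} [NormedAddCommGroup E] [InnerProductSpace ℝ E]
  [NormedAddCommGroup F] [InnerProductSpace ℝ F]

theorem mul_norm_map_sq_le_norm_adjoint_map_sq [FiniteDimensional ℝ E] [FiniteDimensional ℝ F]
    {T : E →ₗ[ℝ] F} {g : ℝ} (hg : 0 ≤ g) (hT : ∀ z, g * ‖z‖ ^ 2 ≤ ‖T z‖ ^ 2) (z : E) :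
    g * ‖T z‖ ^ 2 ≤ ‖T.adjoint (T z)‖ ^ 2 := by
  have hcs : ‖T z‖ ^ 2 ≤ ‖z‖ * ‖T.adjoint (T z)‖ := by
    rw [← real_inner_self_eq_norm_sq, ← LinearMap.adjoint_inner_right]
    exact real_inner_le_norm _ _
  rcases (norm_nonneg (T z)).eq_or_lt with h0 | h0
  · rw [← h0]; simp
  refine le_of_mul_le_mul_right ?_ (pow_pos h0 2)
  calc g * ‖T z‖ ^ 2 * ‖T z‖ ^ 2 = g * (‖T z‖ ^ 2) ^ 2 := by ring
    _ ≤ g * (‖z‖ * ‖T.adjoint (T z)‖) ^ 2 := by gcongr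
    _ = g * ‖z‖ ^ 2 * ‖T.adjoint (T z)‖ ^ 2 := by ring
    _ ≤ ‖T z‖ ^ 2 * ‖T.adjoint (T z)‖ ^ 2 := by gcongr; exact hT z
    _ = _ := mul_comm _ _

/- `T u - σ • u` is an eigenvector for `-σ`, where the quadratic form of `T` is too negative. -/
theorem map_eq_smul_of_map_map_eq_sq_smul {T : E →ₗ[ℝ] E} {ε σ : ℝ}
    (hT : ∀ y, -ε * ‖y‖ ^ 2 ≤ ⟪T y, y⟫) (hσ : ε < σ) {u : E} (hu : T (T u) = σ ^ 2 • u) :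
    T u = σ • u := by
  set y := T u - σ • u with hy
  have hTy : T y = -σ • y := by
    rw [hy, map_sub, map_smul, hu]
    module
  have hle : -ε * ‖y‖ ^ 2 ≤ -σ * ‖y‖ ^ 2 := by
    simpa [hTy, inner_smul_left, real_inner_self_eq_norm_sq] using hT y
  have hy0 : ‖y‖ ^ 2 = 0 := by nlinarith [sq_nonneg ‖y‖]
  exact sub_eq_zero.1 (norm_eq_zero.1 (pow_eq_zero_iff two_ne_zero |>.1 hy0))

/- Courant–Fischer: some nonzero `L z` is orthogonal to the first `k` coordinate vectors. -/
theorem le_apply_of_mul_norm_le_norm_diagonal {N : ℕ} {s : Fin N → ℝ} (hs : Antitone s)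
    (hs0 : ∀ i, 0 ≤ s i) [FiniteDimensional ℝ E] {L : E →ₗ[ℝ] EuclideanSpace ℝ (Fin N)}
    (hL : Function.Injective L) {c : ℝ}
    (hc : ∀ z, c * ‖L z‖ ≤ ‖(Matrix.diagonal s).toEuclideanLin (L z)‖) {k : Fin N}
    (hk : k < Module.finrank ℝ E) : c ≤ s k := by
  obtain ⟨z, hz0, hz⟩ : ∃ z, z ≠ 0 ∧ ∀ i < k, L z i = 0 := by
    let restr : EuclideanSpace ℝ (Fin N) →ₗ[ℝ] (Finset.Iio k → ℝ) :=
      LinearMap.funLeft ℝ ℝ Subtype.val ∘ₗ (WithLp.linearEquiv 2 ℝ (Fin N → ℝ)).toLinearMap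
    have hker : LinearMap.ker (restr ∘ₗ L) ≠ ⊥ := LinearMap.ker_ne_bot_of_finrank_lt <| by
      rwa [Module.finrank_fintype_fun_eq_card, Fintype.card_coe, Fin.card_Iio]
    obtain ⟨z, hz, hz0⟩ := Submodule.exists_mem_ne_zero_of_ne_bot hker
    exact ⟨z, hz0, fun i hi => congrFun (LinearMap.mem_ker.1 hz) ⟨i, Finset.mem_Iio.2 hi⟩⟩
  have hle : ‖(Matrix.diagonal s).toEuclideanLin (L z)‖ ≤ s k * ‖L z‖ := by
    refine le_of_sq_le_sq ?_ (mul_nonneg (hs0 k) (norm_nonneg _))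
    simp only [mul_pow, EuclideanSpace.norm_sq_eq, Finset.mul_sum]
    refine Finset.sum_le_sum fun i _ => ?_
    rcases lt_or_ge i k with hik | hik
    · simp [Matrix.mulVec_diagonal, hz i hik]
    · simp only [Matrix.ofLp_toLpLin, Matrix.toLin'_apply, Matrix.mulVec_diagonal, norm_mul,
        mul_pow, Real.norm_eq_abs, sq_abs]
      gcongr
      · exact hs0 i
      · exact hs hik
  exact le_of_mul_le_mul_right ((hc z).trans hle)
    (norm_pos_iff.2 ((map_ne_zero_iff L hL).2 hz0))

end Eigenvalues

section QuadraticForm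

open scoped Matrix.Norms.L2Operator
open Matrix

variable {l m n : Type*} [Fintype l] [Fintype m] [Fintype n]

theorem norm_toEuclideanLin_sq [DecidableEq n] (B : Matrix m n ℝ) (v : EuclideanSpace ℝ n) :
    ‖B.toEuclideanLin v‖ ^ 2 = ⟪(Bᵀ * B).toEuclideanLin v, v⟫ := by
  classical
  rw [toLpLin_mul_same, LinearMap.comp_apply, ← conjTranspose_eq_transpose_of_trivial,
    toEuclideanLin_conjTranspose_eq_adjoint, LinearMap.adjoint_inner_left,
    real_inner_self_eq_norm_sq]

theorem norm_toEuclideanLin_eq_of_transpose_mul_self_eq [DecidableEq n] {B : Matrix m n ℝ}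
    {C : Matrix l n ℝ} (h : Bᵀ * B = Cᵀ * C) (v : EuclideanSpace ℝ n) :
    ‖B.toEuclideanLin v‖ = ‖C.toEuclideanLin v‖ := by
  rw [← sq_eq_sq₀ (norm_nonneg _) (norm_nonneg _), norm_toEuclideanLin_sq,
    norm_toEuclideanLin_sq, h]

theorem norm_transpose_sq_sub_le_inner_toEuclideanLin [DecidableEq m] (A : Matrix m m ℝ)
    (X : Matrix m n ℝ) (y : EuclideanSpace ℝ m) :
    ‖Xᵀ.toEuclideanLin y‖ ^ 2 - ‖A - X * Xᵀ‖ * ‖y‖ ^ 2 ≤ ⟪A.toEuclideanLin y, y⟫ := by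
  have hsplit : ⟪A.toEuclideanLin y, y⟫ =
      ‖Xᵀ.toEuclideanLin y‖ ^ 2 + ⟪(A - X * Xᵀ).toEuclideanLin y, y⟫ := by
    rw [norm_toEuclideanLin_sq, transpose_transpose, ← inner_add_left, ← LinearMap.add_apply,
      ← map_add, add_sub_cancel]
  have hnoise : |⟪(A - X * Xᵀ).toEuclideanLin y, y⟫| ≤ ‖A - X * Xᵀ‖ * ‖y‖ * ‖y‖ :=
    (abs_real_inner_le_norm _ _).trans (by gcongr; exact norm_toEuclideanLin_le _ _)
  rw [hsplit]
  linarith [neg_le_of_abs_le hnoise, mul_assoc ‖A - X * Xᵀ‖ ‖y‖ ‖y‖, sq ‖y‖]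

variable [DecidableEq m] [DecidableEq n]

theorem mul_norm_le_norm_toEuclideanLin_map {A : Matrix m m ℝ} {X : Matrix m n ℝ} {g : ℝ}
    (hg : 0 ≤ g) (hX : ∀ z, g * ‖z‖ ^ 2 ≤ ‖X.toEuclideanLin z‖ ^ 2) (z : EuclideanSpace ℝ n) :
    (g - ‖A - X * Xᵀ‖) * ‖X.toEuclideanLin z‖ ≤ ‖A.toEuclideanLin (X.toEuclideanLin z)‖ := by
  set y := X.toEuclideanLin z
  rcases (norm_nonneg y).eq_or_lt with h0 | h0
  · rw [← h0, mul_zero]; exact norm_nonneg _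
  refine le_of_mul_le_mul_right ?_ h0
  have hgram : g * ‖y‖ ^ 2 ≤ ‖Xᵀ.toEuclideanLin y‖ ^ 2 := by
    rw [← conjTranspose_eq_transpose_of_trivial, toEuclideanLin_conjTranspose_eq_adjoint]
    exact mul_norm_map_sq_le_norm_adjoint_map_sq hg hX z
  calc (g - ‖A - X * Xᵀ‖) * ‖y‖ * ‖y‖ = g * ‖y‖ ^ 2 - ‖A - X * Xᵀ‖ * ‖y‖ ^ 2 := by ring
    _ ≤ ‖Xᵀ.toEuclideanLin y‖ ^ 2 - ‖A - X * Xᵀ‖ * ‖y‖ ^ 2 := by gcongr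
    _ ≤ ⟪A.toEuclideanLin y, y⟫ := norm_transpose_sq_sub_le_inner_toEuclideanLin A X y
    _ ≤ ‖A.toEuclideanLin y‖ * ‖y‖ := real_inner_le_norm _ _

theorem mul_eq_mul_diagonal_of_mul_mul_eq {A : Matrix m m ℝ} {ε : ℝ}
    (hA : ∀ y, -ε * ‖y‖ ^ 2 ≤ ⟪A.toEuclideanLin y, y⟫) {U : Matrix m n ℝ} {σ : n → ℝ}
    (hσ : ∀ k, ε < σ k) (hU : A * (A * U) = U * diagonal (fun k => σ k ^ 2)) :
    A * U = U * diagonal σ := by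
  have hcol (k : n) :
      A.toEuclideanLin (WithLp.toLp 2 (U.col k)) = σ k • WithLp.toLp 2 (U.col k) := by
    refine map_eq_smul_of_map_map_eq_sq_smul hA (hσ k) ?_
    ext i
    have := congr($hU i k)
    rw [mul_diagonal, mul_comm] at this
    exact this
  ext i k
  rw [mul_diagonal, mul_comm]
  exact congr($(hcol k) i)

end QuadraticForm

section MatrixAbs

open scoped Matrix.Norms.L2Operator MatrixOrder
open Matrix

variable {d n : ℕ} {A V : Matrix (Fin n) (Fin n) ℝ} {s : Fin n → ℝ}

theorem matrixAbs_mul_matrixAbs (A : Matrix (Fin n) (Fin n) ℝ) :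
    matrixAbs A * matrixAbs A = Aᵀ * A :=
  CFC.sqrt_mul_sqrt_self _ <| by
    simpa [nonneg_iff_posSemidef] using posSemidef_conjTranspose_mul_self A

theorem posSemidef_matrixAbs (A : Matrix (Fin n) (Fin n) ℝ) : (matrixAbs A).PosSemidef :=
  nonneg_iff_posSemidef.1 (CFC.sqrt_nonneg _)

theorem matrixAbs_eigenvalue_nonneg (hV : V ∈ orthogonalGroup (Fin n) ℝ)
    (hA : matrixAbs A = V * diagonal s * Vᵀ) (i : Fin n) : 0 ≤ s i := by
  have hVV : Vᵀ * V = 1 := (mem_orthogonalGroup_iff' (Fin n) ℝ).1 hV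
  have hdiag : Vᵀ * matrixAbs A * V = diagonal s := by
    rw [hA, ← Matrix.mul_assoc, ← Matrix.mul_assoc, hVV, Matrix.one_mul, Matrix.mul_assoc, hVV,
      Matrix.mul_one]
  have := (posSemidef_matrixAbs A).conjTranspose_mul_mul_same V
  rw [conjTranspose_eq_transpose_of_trivial, hdiag, posSemidef_diagonal_iff] at this
  exact this i

/- Weyl's inequality: `V` turns the column space of `X` into a `d`-dimensional test space for the
min-max characterization of the `s i`. -/
theorem sub_le_matrixAbs_eigenvalue (hV : V ∈ orthogonalGroup (Fin n) ℝ) (hs : Antitone s)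
    (hA : matrixAbs A = V * diagonal s * Vᵀ) {X : Matrix (Fin n) (Fin d) ℝ} {g : ℝ} (hg : 0 < g)
    (hX : ∀ z, g * ‖z‖ ^ 2 ≤ ‖X.toEuclideanLin z‖ ^ 2) (h : d ≤ n) (k : Fin d) :
    g - ‖A - X * Xᵀ‖ ≤ s (Fin.castLE h k) := by
  have hVV : Vᵀ * V = 1 := (mem_orthogonalGroup_iff' (Fin n) ℝ).1 hV
  have hVV' : V * Vᵀ = 1 := (mem_orthogonalGroup_iff (Fin n) ℝ).1 hV
  have hnorm (z) : ‖(Vᵀ * X).toEuclideanLin z‖ = ‖X.toEuclideanLin z‖ := by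
    refine norm_toEuclideanLin_eq_of_transpose_mul_self_eq ?_ z
    rw [transpose_mul, transpose_transpose, Matrix.mul_assoc, ← Matrix.mul_assoc V, hVV',
      Matrix.one_mul]
  have habs (z) : ‖(diagonal s * (Vᵀ * X)).toEuclideanLin z‖ = ‖(A * X).toEuclideanLin z‖ := by
    refine norm_toEuclideanLin_eq_of_transpose_mul_self_eq ?_ z
    calc (diagonal s * (Vᵀ * X))ᵀ * (diagonal s * (Vᵀ * X))
        = Xᵀ * (V * diagonal s * (Vᵀ * V) * diagonal s * Vᵀ) * X := by
          rw [hVV]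
          simp only [transpose_mul, transpose_transpose, diagonal_transpose, Matrix.mul_assoc,
            Matrix.one_mul]
      _ = Xᵀ * (matrixAbs A * matrixAbs A) * X := by
          rw [hA]
          simp only [Matrix.mul_assoc]
      _ = (A * X)ᵀ * (A * X) := by
          rw [matrixAbs_mul_matrixAbs, transpose_mul]
          simp only [Matrix.mul_assoc]
  have hinj : Function.Injective (Vᵀ * X).toEuclideanLin := by
    refine (injective_iff_map_eq_zero _).2 fun z hz => ?_
    have hXz := hX z
    rw [← hnorm, hz, norm_zero, zero_pow two_ne_zero] at hXz
    exact norm_eq_zero.1 (pow_eq_zero_iff two_ne_zero |>.1 (by nlinarith [sq_nonneg ‖z‖]))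
  refine le_apply_of_mul_norm_le_norm_diagonal hs (matrixAbs_eigenvalue_nonneg hV hA) hinj
    (fun z => ?_) (by simp)
  rw [hnorm, ← LinearMap.comp_apply, ← toLpLin_mul_same, habs, toLpLin_mul_same]
  exact mul_norm_le_norm_toEuclideanLin_map hg.le hX z

theorem IsASE.exists_eigenvalues {Xhat : Matrix (Fin n) (Fin d) ℝ} (hXhat : IsASE d A Xhat)
    (hA : A.IsSymm) {X : Matrix (Fin n) (Fin d) ℝ} {g : ℝ}
    (hX : ∀ z, g * ‖z‖ ^ 2 ≤ ‖X.toEuclideanLin z‖ ^ 2) (hg : 2 * ‖A - X * Xᵀ‖ < g) :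
    ∃ σ : Fin d → ℝ, (∀ k, g - ‖A - X * Xᵀ‖ ≤ σ k) ∧
      A * Xhat = Xhat * diagonal σ ∧ Xhatᵀ * Xhat = diagonal σ := by
  obtain ⟨h, V, s, hV, hs, hAV, rfl⟩ := hXhat
  have hg0 : 0 < g := by linarith [norm_nonneg (A - X * Xᵀ)]
  have hVV : Vᵀ * V = 1 := (mem_orthogonalGroup_iff' (Fin n) ℝ).1 hV
  have hs0 := matrixAbs_eigenvalue_nonneg hV hAV
  set σ : Fin d → ℝ := fun k => s (Fin.castLE h k) with hσ
  set U := V.submatrix id (Fin.castLE h) with hU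
  have hle (k : Fin d) : g - ‖A - X * Xᵀ‖ ≤ σ k := sub_le_matrixAbs_eigenvalue hV hs hAV hg0 hX h k
  have hUU : Uᵀ * U = 1 := by
    ext i j
    simpa [mul_apply, one_apply, hU] using congr($hVV (Fin.castLE h i) (Fin.castLE h j))
  have habs : matrixAbs A * U = U * diagonal σ := by
    ext i k
    have hAV' : matrixAbs A * V = V * diagonal s := by
      rw [hAV, Matrix.mul_assoc, hVV, Matrix.mul_one]
    have := congr($hAV' i (Fin.castLE h k))
    rw [mul_diagonal] at this ⊢
    exact this
  have hAAU : A * (A * U) = U * diagonal (fun k => σ k ^ 2) := by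
    calc A * (A * U) = matrixAbs A * (matrixAbs A * U) := by
          rw [← Matrix.mul_assoc, ← Matrix.mul_assoc, matrixAbs_mul_matrixAbs, hA.eq]
      _ = U * diagonal (fun k => σ k ^ 2) := by
          rw [habs, ← Matrix.mul_assoc, habs, Matrix.mul_assoc, diagonal_mul_diagonal]
          simp only [sq]
  have hAU : A * U = U * diagonal σ := by
    refine mul_eq_mul_diagonal_of_mul_mul_eq (ε := ‖A - X * Xᵀ‖) (fun y => ?_)
      (fun k => by linarith [hle k]) hAAU
    linarith [norm_transpose_sq_sub_le_inner_toEuclideanLin A X y,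
      sq_nonneg ‖Xᵀ.toEuclideanLin y‖]
  refine ⟨σ, hle, ?_, ?_⟩
  · rw [← Matrix.mul_assoc, hAU, Matrix.mul_assoc, Matrix.mul_assoc, diagonal_mul_diagonal,
      diagonal_mul_diagonal]
    simp only [mul_comm]
  · rw [transpose_mul, diagonal_transpose, Matrix.mul_assoc, ← Matrix.mul_assoc Uᵀ, hUU,
      Matrix.one_mul, diagonal_mul_diagonal]
    simp only [hσ, Real.mul_self_sqrt (hs0 _)]

end MatrixAbs

section RowError

open scoped Matrix.Norms.L2Operator
open WithLp Matrix

variable {m n : Type*} [Fintype m] [Fintype n] [DecidableEq n]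
  {E : Matrix m m ℝ} {X Z Q : Matrix m n ℝ} {r : n → ℝ}

theorem mul_eq_mul_diagonal_of_perturbation (hQ : Q = Z * diagonal r)
    (hZ : (X * Xᵀ + E) * Q = Z) :
    E * Q = (E * X * (Xᵀ * Q) + E * (E * Q)) * diagonal r := by
  have hsplit : E * X * (Xᵀ * Q) + E * (E * Q) = E * Z := by
    rw [← hZ]
    simp only [Matrix.mul_add, Matrix.add_mul, Matrix.mul_assoc]
  rw [hsplit, Matrix.mul_assoc, ← hQ]

theorem l2_opNorm_sq_eq_norm (hQ : Q = Z * diagonal r) (hQZ : Qᵀ * Z = 1) : ‖Q‖ ^ 2 = ‖r‖ := by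
  rw [← l2_opNorm_transpose_mul_self]
  nth_rewrite 2 [hQ]
  rw [← Matrix.mul_assoc, hQZ, Matrix.one_mul, l2_opNorm_diagonal]

theorem transpose_mul_self_sub_one_of_perturbation (hZ : (X * Xᵀ + E) * Q = Z)
    (hQZ : Qᵀ * Z = 1) : (Xᵀ * Q)ᵀ * (Xᵀ * Q) - 1 = -(Qᵀ * (E * Q)) := by
  rw [← hQZ, ← hZ]
  simp only [transpose_mul, transpose_transpose, Matrix.mul_add, Matrix.add_mul, Matrix.mul_assoc,
    sub_add_cancel_left]

variable [DecidableEq m]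

theorem l2_opNorm_noise_mul_le (hQ : Q = Z * diagonal r) (hZ : (X * Xᵀ + E) * Q = Z)
    (hE : 2 * ‖E‖ * ‖r‖ ≤ 1) : ‖E * Q‖ ≤ 2 * ‖r‖ * (‖E * X‖ * ‖Xᵀ * Q‖) := by
  have hle : ‖E * Q‖ ≤ (‖E * X‖ * ‖Xᵀ * Q‖ + ‖E‖ * ‖E * Q‖) * ‖r‖ := by
    calc ‖E * Q‖ = ‖(E * X * (Xᵀ * Q) + E * (E * Q)) * diagonal r‖ := by
          rw [← mul_eq_mul_diagonal_of_perturbation hQ hZ]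
      _ ≤ ‖E * X * (Xᵀ * Q) + E * (E * Q)‖ * ‖r‖ := by
          rw [← l2_opNorm_diagonal r]
          exact l2_opNorm_mul _ _
      _ ≤ _ := by
          gcongr
          exact (norm_add_le _ _).trans (add_le_add (l2_opNorm_mul _ _) (l2_opNorm_mul _ _))
  nlinarith [mul_le_mul_of_nonneg_right hE (norm_nonneg (E * Q))]

omit [DecidableEq m] in
theorem norm_row_noise_mul_le (hQ : Q = Z * diagonal r) (hZ : (X * Xᵀ + E) * Q = Z) (i : m) :
    ‖toLp 2 ((E * Q) i)‖ ≤
      (‖toLp 2 ((E * X) i)‖ * ‖Xᵀ * Q‖ + ‖toLp 2 (E i)‖ * ‖E * Q‖) * ‖r‖ := by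
  rw [mul_eq_mul_diagonal_of_perturbation hQ hZ]
  refine (norm_row_mul_le _ _ i).trans ?_
  rw [l2_opNorm_diagonal, ← mul_eq_mul_diagonal_of_perturbation hQ hZ]
  gcongr
  calc ‖toLp 2 ((E * X * (Xᵀ * Q) + E * (E * Q)) i)‖
      ≤ ‖toLp 2 ((E * X * (Xᵀ * Q)) i)‖ + ‖toLp 2 ((E * (E * Q)) i)‖ := norm_row_add_le _ _ i
    _ ≤ _ := add_le_add (norm_row_mul_le _ _ i) (norm_row_mul_le _ _ i)

omit [DecidableEq m] in
theorem exists_orthogonal_norm_row_sub_le (hZ : (X * Xᵀ + E) * Q = Z)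
    (hQZ : Qᵀ * Z = 1) (hsmall : ‖Q‖ * ‖E * Q‖ < 1) :
    ∃ W ∈ orthogonalGroup n ℝ, ∀ i,
      ‖toLp 2 ((Z - X * W) i)‖ ≤
        ‖toLp 2 ((E * Q) i)‖ + ‖toLp 2 (X i)‖ * (‖Q‖ * ‖E * Q‖) := by
  have hM : ‖(Xᵀ * Q)ᵀ * (Xᵀ * Q) - 1‖ ≤ ‖Q‖ * ‖E * Q‖ := by
    classical
    rw [transpose_mul_self_sub_one_of_perturbation hZ hQZ, norm_neg, ← l2_opNorm_transpose Q]
    exact l2_opNorm_mul _ _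
  obtain ⟨W, hW, hMW⟩ := exists_mem_orthogonalGroup_norm_sub_le _ (hM.trans_lt hsmall)
  refine ⟨W, hW, fun i => ?_⟩
  have hsplit : Z - X * W = E * Q + X * (Xᵀ * Q - W) := by
    nth_rewrite 1 [← hZ]
    rw [Matrix.mul_sub, Matrix.add_mul, Matrix.mul_assoc]
    abel
  calc ‖toLp 2 ((Z - X * W) i)‖ ≤ ‖toLp 2 ((E * Q) i)‖ + ‖toLp 2 ((X * (Xᵀ * Q - W)) i)‖ := by
        rw [hsplit]
        exact norm_row_add_le _ _ i
    _ ≤ _ := by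
        gcongr
        exact (norm_row_mul_le _ _ i).trans (by gcongr; exact hMW.trans hM)

section Scale

variable {N κ τ : ℝ} (hN : 0 < N) (hκ : 0 < κ)
include hN hκ

omit [DecidableEq m] in
theorem l2_opNorm_le_of_scale (hQ : Q = Z * diagonal r) (hQZ : Qᵀ * Z = 1) (hκ1 : κ ≤ 1)
    (hr : ‖r‖ ≤ 1 / (κ * N)) : ‖Q‖ ≤ 1 / (κ * √N) := by
  refine le_of_sq_le_sq ?_ (by positivity)
  calc ‖Q‖ ^ 2 ≤ 1 / (κ * N) := (l2_opNorm_sq_eq_norm hQ hQZ).trans_le hr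
    _ ≤ 1 / (κ ^ 2 * N) := by
        gcongr
        exact pow_le_of_le_one hκ.le hκ1 two_ne_zero
    _ = (1 / (κ * √N)) ^ 2 := by rw [div_pow, mul_pow, Real.sq_sqrt hN.le, one_pow]

omit [DecidableEq m] in
theorem l2_opNorm_transpose_mul_le_of_scale (hX : ‖X‖ ≤ √N) (hQ : ‖Q‖ ≤ 1 / (κ * √N)) :
    ‖Xᵀ * Q‖ ≤ 1 / κ := by
  classical
  calc ‖Xᵀ * Q‖ ≤ ‖X‖ * ‖Q‖ := l2_opNorm_transpose X ▸ l2_opNorm_mul _ _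
    _ ≤ √N * (1 / (κ * √N)) := by gcongr
    _ = 1 / κ := by field_simp

theorem l2_opNorm_noise_mul_le_of_scale (hQ : Q = Z * diagonal r) (hZ : (X * Xᵀ + E) * Q = Z)
    (hr : ‖r‖ ≤ 1 / (κ * N)) (hE : 2 * ‖E‖ ≤ κ * N) (hXQ : ‖Xᵀ * Q‖ ≤ 1 / κ)
    (hEX : ‖E * X‖ ≤ √N * τ) : ‖E * Q‖ ≤ 2 * τ / (κ ^ 2 * √N) := by
  have hEr : 2 * ‖E‖ * ‖r‖ ≤ 1 := by
    calc 2 * ‖E‖ * ‖r‖ ≤ κ * N * (1 / (κ * N)) := by gcongr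
      _ = 1 := by field_simp
  calc ‖E * Q‖ ≤ 2 * ‖r‖ * (‖E * X‖ * ‖Xᵀ * Q‖) := l2_opNorm_noise_mul_le hQ hZ hEr
    _ ≤ 2 * (1 / (κ * N)) * (√N * τ * (1 / κ)) := by
        gcongr
        exact (norm_nonneg _).trans hEX
    _ = 2 * τ / κ ^ 2 * (√N / N) := by ring
    _ = 2 * τ / (κ ^ 2 * √N) := by rw [Real.sqrt_div_self', mul_one_div, div_div]

end Scale

theorem exists_orthogonal_norm_row_sub_le_of_scale [Nonempty m] (hQ : Q = Z * diagonal r)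
    (hZ : (X * Xᵀ + E) * Q = Z) (hQZ : Qᵀ * Z = 1) {N κ τ : ℝ} (hN : N = Fintype.card m)
    (hκ : 0 < κ) (hκ1 : κ ≤ 1) (hr : ‖r‖ ≤ 1 / (κ * N)) (hE : 2 * ‖E‖ ≤ κ * N)
    (hXrow : ∀ i, ‖toLp 2 (X i)‖ ≤ 1) (hErow : ∀ i, ‖toLp 2 (E i)‖ ≤ √N)
    (hEXrow : ∀ i, ‖toLp 2 ((E * X) i)‖ ≤ τ) (hτ : 2 * τ < κ ^ 3 * N) :
    ∃ W ∈ orthogonalGroup n ℝ, ∀ i, ‖toLp 2 ((Z - X * W) i)‖ ≤ 5 / κ ^ 3 * (τ / N) := by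
  have hN0 : 0 < N := by rw [hN]; exact_mod_cast Fintype.card_pos
  have hτ0 : 0 ≤ τ := (norm_nonneg _).trans (hEXrow (Classical.arbitrary m))
  have hX : ‖X‖ ≤ √N := by
    simpa [hN] using l2_opNorm_le_sqrt_card_mul_of_row_le X zero_le_one hXrow
  have hEX : ‖E * X‖ ≤ √N * τ := hN ▸ l2_opNorm_le_sqrt_card_mul_of_row_le _ hτ0 hEXrow
  have hQn := l2_opNorm_le_of_scale hN0 hκ hQ hQZ hκ1 hr
  have hXQ := l2_opNorm_transpose_mul_le_of_scale hN0 hκ hX hQn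
  have hEQ := l2_opNorm_noise_mul_le_of_scale hN0 hκ hQ hZ hr hE hXQ hEX
  have hQEQ : ‖Q‖ * ‖E * Q‖ ≤ 2 / κ ^ 3 * (τ / N) := by
    calc ‖Q‖ * ‖E * Q‖ ≤ 1 / (κ * √N) * (2 * τ / (κ ^ 2 * √N)) := by gcongr
      _ = 2 / κ ^ 3 * (τ / (√N * √N)) := by field_simp
      _ = 2 / κ ^ 3 * (τ / N) := by rw [Real.mul_self_sqrt hN0.le]
  have hEQrow (i : m) : ‖toLp 2 ((E * Q) i)‖ ≤ 3 / κ ^ 3 * (τ / N) := by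
    calc ‖toLp 2 ((E * Q) i)‖
        ≤ (‖toLp 2 ((E * X) i)‖ * ‖Xᵀ * Q‖ + ‖toLp 2 (E i)‖ * ‖E * Q‖) * ‖r‖ :=
          norm_row_noise_mul_le hQ hZ i
      _ ≤ (τ * (1 / κ) + √N * (2 * τ / (κ ^ 2 * √N))) * (1 / (κ * N)) := by
          gcongr
          exacts [hEXrow i, hErow i]
      _ = (κ + 2) / κ ^ 3 * (τ / N) := by field_simp
      _ ≤ 3 / κ ^ 3 * (τ / N) := by gcongr; linarith
  have hsmall : ‖Q‖ * ‖E * Q‖ < 1 := by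
    refine hQEQ.trans_lt ?_
    rwa [div_mul_div_comm, div_lt_one (by positivity)]
  obtain ⟨W, hW, hrow⟩ := exists_orthogonal_norm_row_sub_le hZ hQZ hsmall
  refine ⟨W, hW, fun i => (hrow i).trans ?_⟩
  calc ‖toLp 2 ((E * Q) i)‖ + ‖toLp 2 (X i)‖ * (‖Q‖ * ‖E * Q‖)
      ≤ 3 / κ ^ 3 * (τ / N) + 1 * (2 / κ ^ 3 * (τ / N)) := by
        gcongr
        exacts [hEQrow i, hXrow i]
    _ = 5 / κ ^ 3 * (τ / N) := by ring

end RowError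

section Concentration

open scoped Matrix.Norms.L2Operator
open WithLp Matrix

variable {d n : ℕ}

theorem IsASE.exists_orthogonal_twoToInftyNorm_le [NeZero n] {A : Matrix (Fin n) (Fin n) ℝ}
    {X Xhat : Matrix (Fin n) (Fin d) ℝ} (hXhat : IsASE d A Xhat) (hA : A.IsSymm) {κ τ : ℝ}
    (hκ : 0 < κ) (hκ1 : κ ≤ 1)
    (hX : ∀ z, 2 * (κ * n) * ‖z‖ ^ 2 ≤ ‖X.toEuclideanLin z‖ ^ 2)
    (hE : 2 * ‖A - X * Xᵀ‖ ≤ κ * n) (hXrow : ∀ i, ‖toLp 2 (X i)‖ ≤ 1)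
    (hErow : ∀ i, ‖toLp 2 ((A - X * Xᵀ) i)‖ ≤ √n)
    (hEXrow : ∀ i, ‖toLp 2 (((A - X * Xᵀ) * X) i)‖ ≤ τ) (hτ : 2 * τ < κ ^ 3 * n) :
    ∃ W ∈ orthogonalGroup (Fin d) ℝ, twoToInftyNorm (Xhat - X * W) ≤ 5 / κ ^ 3 * (τ / n) := by
  have hκn : 0 < κ * n := mul_pos hκ (Nat.cast_pos.2 (NeZero.pos n))
  obtain ⟨σ, hσ, hAXhat, hgram⟩ := hXhat.exists_eigenvalues hA hX (by linarith)
  have hσn (k) : κ * n ≤ σ k := by linarith [hσ k]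
  have hσ0 (k) : 0 < σ k := hκn.trans_le (hσn k)
  have hdiag : diagonal σ * diagonal σ⁻¹ = 1 := by
    rw [diagonal_mul_diagonal, diagonal_eq_one]
    exact funext fun k => mul_inv_cancel₀ (hσ0 k).ne'
  have hr : ‖σ⁻¹‖ ≤ 1 / (κ * n) := by
    refine (pi_norm_le_iff_of_nonneg (by positivity)).2 fun k => ?_
    rw [Pi.inv_apply, norm_inv, Real.norm_of_nonneg (hσ0 k).le, inv_eq_one_div]
    exact one_div_le_one_div_of_le hκn (hσn k)
  obtain ⟨W, hW, hrow⟩ := exists_orthogonal_norm_row_sub_le_of_scale (E := A - X * Xᵀ)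
    (Z := Xhat) (Q := Xhat * diagonal σ⁻¹) rfl
    (by rw [add_sub_cancel, ← Matrix.mul_assoc, hAXhat, Matrix.mul_assoc, hdiag, Matrix.mul_one])
    (by rw [transpose_mul, Matrix.mul_assoc, hgram, ← hdiag, diagonal_transpose,
      diagonal_mul_diagonal, diagonal_mul_diagonal]; simp only [mul_comm])
    (N := n) (by simp) hκ hκ1 hr hE hXrow hErow hEXrow hτ
  exact ⟨W, hW, ciSup_le hrow⟩

/-- The centered adjacency matrix `A - 𝔼 A` of a random graph without loops in which `P i j` is the
probability of an edge between `i ≠ j`; the diagonal of `P` is disregarded. -/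
def centeredAdj (A P : Matrix (Fin n) (Fin n) ℝ) : Matrix (Fin n) (Fin n) ℝ :=
  Matrix.of fun i j => if i = j then 0 else A i j - P i j

/-- The event on which the embedding error of a graph with adjacency matrix `A` and latent positions
`X` is controlled: the entries of `(A - 𝔼[A ∣ X]) * X`, the off-diagonal entries of
`(A - 𝔼[A ∣ X]) ^ 2` and the entries of `Xᵀ * X - n • Δ` are all at most `t`. -/
structure IsConcentrated (Δ : Matrix (Fin d) (Fin d) ℝ) (t : ℝ) (A : Matrix (Fin n) (Fin n) ℝ)
    (X : Matrix (Fin n) (Fin d) ℝ) : Prop where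
  isAdjMatrix : A.IsAdjMatrix
  inner_mem_Icc : ∀ i j, (X * Xᵀ) i j ∈ Set.Icc 0 1
  abs_noise_mul_le : ∀ i k, |(centeredAdj A (X * Xᵀ) * X) i k| ≤ t
  abs_noise_sq_le : ∀ i j, i ≠ j →
    |(centeredAdj A (X * Xᵀ) * centeredAdj A (X * Xᵀ)) i j| ≤ t
  abs_gram_sub_le : ∀ k l, |(Xᵀ * X - (n : ℝ) • Δ) k l| ≤ t

section CenteredAdj

variable {A P : Matrix (Fin n) (Fin n) ℝ}

theorem centeredAdj_apply_of_ne {i j : Fin n} (hij : i ≠ j) :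
    centeredAdj A P i j = A i j - P i j := by
  simp [centeredAdj, hij]

theorem centeredAdj_apply_self (i : Fin n) : centeredAdj A P i i = 0 := by
  simp [centeredAdj]

theorem transpose_centeredAdj (hA : A.IsSymm) (hP : P.IsSymm) :
    (centeredAdj A P)ᵀ = centeredAdj A P := by
  ext i j
  simp only [centeredAdj, transpose_apply, of_apply, hA.apply i j, hP.apply i j, eq_comm]

theorem sub_eq_centeredAdj_sub (hA : A.IsAdjMatrix) :
    A - P = centeredAdj A P - diagonal P.diag := by
  ext i j
  rcases eq_or_ne i j with rfl | hij
  · simp [centeredAdj_apply_self, hA.apply_diag i]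
  · simp [centeredAdj_apply_of_ne hij, hij]

theorem abs_sub_apply_le_one (hA : A.IsAdjMatrix) (hP : ∀ i j, P i j ∈ Set.Icc (0 : ℝ) 1)
    (i j : Fin n) : |(A - P) i j| ≤ 1 := by
  obtain ⟨h0, h1⟩ := hP i j
  rw [Matrix.sub_apply, abs_le]
  rcases hA.zero_or_one i j with h | h <;> rw [h] <;> constructor <;> linarith

theorem abs_centeredAdj_le_one (hA : A.IsAdjMatrix) (hP : ∀ i j, P i j ∈ Set.Icc (0 : ℝ) 1)
    (i j : Fin n) : |centeredAdj A P i j| ≤ 1 := by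
  rcases eq_or_ne i j with rfl | hij
  · simp [centeredAdj_apply_self]
  · rw [centeredAdj_apply_of_ne hij]
    exact abs_sub_apply_le_one hA hP i j

end CenteredAdj

theorem norm_row_le_one_of_inner_le {X : Matrix (Fin n) (Fin d) ℝ}
    (hX : ∀ i, (X * Xᵀ) i i ≤ 1) (i : Fin n) : ‖toLp 2 (X i)‖ ≤ 1 := by
  have hsq : ‖toLp 2 (X i)‖ ^ 2 = (X * Xᵀ) i i := by
    rw [EuclideanSpace.norm_sq_eq]
    simp [mul_apply, sq]
  refine le_of_sq_le_sq ?_ zero_le_one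
  rw [hsq, one_pow]
  exact hX i

theorem l2_opNorm_le_of_diag_le_of_offDiag_le {B : Matrix (Fin n) (Fin n) ℝ} {s t : ℝ} (hs : 0 ≤ s)
    (ht : 0 ≤ t) (hdiag : ∀ i, |B i i| ≤ s) (hoff : ∀ i j, i ≠ j → |B i j| ≤ t) :
    ‖B‖ ≤ s + n * t := by
  have hB : ‖diagonal B.diag‖ ≤ s := by
    rw [l2_opNorm_diagonal]
    exact (pi_norm_le_iff_of_nonneg hs).2 hdiag
  have hB' : ‖B - diagonal B.diag‖ ≤ n * t := by
    refine (l2_opNorm_le_card_mul_of_entry_le _ ht fun i j => ?_).trans_eq (by simp)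
    rcases eq_or_ne i j with rfl | hij
    · simpa using ht
    · simpa [hij] using hoff i j hij
  calc ‖B‖ = ‖diagonal B.diag + (B - diagonal B.diag)‖ := by rw [add_sub_cancel]
    _ ≤ s + n * t := (norm_add_le _ _).trans (add_le_add hB hB')

namespace IsConcentrated

variable {Δ : Matrix (Fin d) (Fin d) ℝ} {t κ : ℝ} {A : Matrix (Fin n) (Fin n) ℝ}
  {X : Matrix (Fin n) (Fin d) ℝ}

theorem norm_row_position_le (h : IsConcentrated Δ t A X) (i : Fin n) : ‖toLp 2 (X i)‖ ≤ 1 :=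
  norm_row_le_one_of_inner_le (fun i => (h.inner_mem_Icc i i).2) i

theorem norm_row_noise_le (h : IsConcentrated Δ t A X) (i : Fin n) :
    ‖toLp 2 ((A - X * Xᵀ) i)‖ ≤ √n := by
  simpa using norm_le_sqrt_card_mul (toLp 2 ((A - X * Xᵀ) i)) zero_le_one
    (abs_sub_apply_le_one h.isAdjMatrix h.inner_mem_Icc i)

theorem norm_row_noise_mul_le (h : IsConcentrated Δ t A X) (ht : 0 ≤ t) (i : Fin n) :
    ‖toLp 2 (((A - X * Xᵀ) * X) i)‖ ≤ √d * (t + 1) := by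
  refine (norm_le_sqrt_card_mul (toLp 2 (((A - X * Xᵀ) * X) i)) (by positivity : 0 ≤ t + 1)
    fun k => ?_).trans_eq (by rw [Fintype.card_fin])
  have hdiag : |(X * Xᵀ) i i * X i k| ≤ 1 := by
    rw [abs_mul, abs_of_nonneg (h.inner_mem_Icc i i).1]
    exact mul_le_one₀ (h.inner_mem_Icc i i).2 (abs_nonneg _)
      ((PiLp.norm_apply_le (toLp 2 (X i)) k).trans (h.norm_row_position_le i))
  calc |((A - X * Xᵀ) * X) i k| = |(centeredAdj A (X * Xᵀ) * X) i k - (X * Xᵀ) i i * X i k| := by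
        rw [sub_eq_centeredAdj_sub h.isAdjMatrix, Matrix.sub_mul,
          Matrix.sub_apply, diagonal_mul, diag_apply]
    _ ≤ t + 1 := (abs_sub _ _).trans (add_le_add (h.abs_noise_mul_le i k) hdiag)

theorem l2_opNorm_centeredAdj_sq_le (h : IsConcentrated Δ t A X) (ht : 0 ≤ t) :
    ‖centeredAdj A (X * Xᵀ)‖ ^ 2 ≤ n * (t + 1) := by
  have hP : (X * Xᵀ).IsSymm := by simp [IsSymm]
  rw [← l2_opNorm_transpose_mul_self, transpose_centeredAdj h.isAdjMatrix.symm hP, mul_add_one,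
    add_comm]
  refine l2_opNorm_le_of_diag_le_of_offDiag_le (Nat.cast_nonneg n) ht (fun i => ?_)
    h.abs_noise_sq_le
  calc |(centeredAdj A (X * Xᵀ) * centeredAdj A (X * Xᵀ)) i i|
      ≤ ∑ j, |centeredAdj A (X * Xᵀ) i j * centeredAdj A (X * Xᵀ) j i| := by
        rw [mul_apply]
        exact Finset.abs_sum_le_sum_abs _ _
    _ ≤ ∑ _j : Fin n, 1 := Finset.sum_le_sum fun j _ => by
        rw [abs_mul]
        exact mul_le_one₀ (abs_centeredAdj_le_one h.isAdjMatrix h.inner_mem_Icc i j)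
          (abs_nonneg _) (abs_centeredAdj_le_one h.isAdjMatrix h.inner_mem_Icc j i)
    _ = n := by simp

theorem l2_opNorm_noise_le (h : IsConcentrated Δ t A X) (ht : 0 ≤ t) :
    ‖A - X * Xᵀ‖ ≤ √(n * (t + 1)) + 1 := by
  have hdiag : ‖diagonal (X * Xᵀ).diag‖ ≤ 1 := by
    rw [l2_opNorm_diagonal]
    refine (pi_norm_le_iff_of_nonneg zero_le_one).2 fun i => ?_
    rw [diag_apply, Real.norm_of_nonneg (h.inner_mem_Icc i i).1]
    exact (h.inner_mem_Icc i i).2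
  rw [sub_eq_centeredAdj_sub h.isAdjMatrix]
  exact (norm_sub_le _ _).trans
    (add_le_add (Real.le_sqrt_of_sq_le (h.l2_opNorm_centeredAdj_sq_le ht)) hdiag)

theorem sub_mul_norm_sq_le (h : IsConcentrated Δ t A X) (ht : 0 ≤ t)
    (hΔ : ∀ z, κ * ‖z‖ ^ 2 ≤ ⟪Δ.toEuclideanLin z, z⟫) (z : EuclideanSpace ℝ (Fin d)) :
    (κ * n - d * t) * ‖z‖ ^ 2 ≤ ‖X.toEuclideanLin z‖ ^ 2 := by
  have hgram : ‖Xᵀ * X - (n : ℝ) • Δ‖ ≤ d * t := by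
    simpa using l2_opNorm_le_card_mul_of_entry_le _ ht h.abs_gram_sub_le
  have hdev : |⟪(Xᵀ * X - (n : ℝ) • Δ).toEuclideanLin z, z⟫| ≤ d * t * ‖z‖ * ‖z‖ :=
    (abs_real_inner_le_norm _ _).trans <| by
      gcongr
      exact (norm_toEuclideanLin_le _ z).trans (by gcongr)
  have hsplit : ‖X.toEuclideanLin z‖ ^ 2 =
      n * ⟪Δ.toEuclideanLin z, z⟫ + ⟪(Xᵀ * X - (n : ℝ) • Δ).toEuclideanLin z, z⟫ := by
    rw [norm_toEuclideanLin_sq, ← real_inner_smul_left, ← inner_add_left,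
      ← LinearMap.smul_apply, ← LinearMap.add_apply, ← map_smul, ← map_add, add_sub_cancel]
  have := mul_le_mul_of_nonneg_left (hΔ z) (Nat.cast_nonneg (α := ℝ) n)
  rw [hsplit]
  nlinarith [neg_le_of_abs_le hdev]

theorem exists_orthogonal_twoToInftyNorm_le [NeZero n] (h : IsConcentrated Δ t A X) (ht : 0 ≤ t)
    (hκ : 0 < κ) (hκ1 : κ ≤ 1) (hΔ : ∀ z, 4 * κ * ‖z‖ ^ 2 ≤ ⟪Δ.toEuclideanLin z, z⟫)
    (hn : 16 * (d + 1) * (t + 1) ≤ κ ^ 3 * n) {Xhat : Matrix (Fin n) (Fin d) ℝ}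
    (hXhat : IsASE d A Xhat) :
    ∃ W ∈ orthogonalGroup (Fin d) ℝ,
      twoToInftyNorm (Xhat - X * W) ≤ 5 / κ ^ 3 * (√d * (t + 1) / n) := by
  have hn0 : (0 : ℝ) < n := Nat.cast_pos.2 (NeZero.pos n)
  have hκn : κ ^ 3 * n ≤ κ * n :=
    mul_le_mul_of_nonneg_right (pow_le_of_le_one hκ.le hκ1 three_ne_zero) hn0.le
  have hκn' : κ ^ 3 * n ≤ κ ^ 2 * n :=
    mul_le_mul_of_nonneg_right (pow_le_pow_of_le_one hκ.le hκ1 (by norm_num)) hn0.le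
  have hd0 : (0 : ℝ) ≤ d := Nat.cast_nonneg d
  have hdt : 0 ≤ d * t := by positivity
  have ht1 : 16 * (t + 1) ≤ κ ^ 2 * n := by linarith
  have hsqrt : √(n * (t + 1)) ≤ κ * n / 4 := by
    refine Real.sqrt_le_iff.2 ⟨by positivity, ?_⟩
    linarith [mul_le_mul_of_nonneg_right ht1 hn0.le]
  have hsqrtd : √d ≤ d + 1 := Real.sqrt_le_iff.2 ⟨by positivity, by nlinarith [hd0]⟩
  refine hXhat.exists_orthogonal_twoToInftyNorm_le (τ := √d * (t + 1)) h.isAdjMatrix.symm hκ hκ1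
    (fun z => ?_) ?_ h.norm_row_position_le h.norm_row_noise_le (h.norm_row_noise_mul_le ht) ?_
  · refine le_trans ?_ (h.sub_mul_norm_sq_le ht hΔ z)
    gcongr
    linarith
  · linarith [h.l2_opNorm_noise_le ht]
  · linarith [mul_le_mul_of_nonneg_right hsqrtd (by linarith : 0 ≤ t + 1)]

end IsConcentrated

end Concentration

section Hoeffding

open Measure

variable {Ω ι J : Type*} [MeasurableSpace Ω] {μ : Measure Ω}

theorem iIndepFun_curry {κ : J → Type*} {𝓧 : (j : J) → κ j → Type*}
    [∀ j k, MeasurableSpace (𝓧 j k)] {Y : (j : J) → (k : κ j) → Ω → 𝓧 j k}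
    (hY : ∀ j k, Measurable (Y j k))
    (h : iIndepFun (fun (p : (j : J) × κ j) => Y p.1 p.2) μ) :
    iIndepFun (fun j ω k => Y j k ω) μ := by
  have := h.isProbabilityMeasure
  have hprob (j k) : IsProbabilityMeasure (μ.map (Y j k)) :=
    isProbabilityMeasure_map (hY j k).aemeasurable
  have hblock (j) : infinitePi (fun k => μ.map (Y j k)) = μ.map fun ω k => Y j k ω :=
    ((h.precomp sigma_mk_injective).map_fun_eq_infinitePi_map (hY j)).symm
  rw [iIndepFun_iff_map_fun_eq_infinitePi_map (by fun_prop)]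
  calc μ.map (fun ω j k => Y j k ω)
      = (μ.map fun ω (p : (j : J) × κ j) => Y p.1 p.2 ω).map (MeasurableEquiv.piCurry 𝓧) := by
        rw [map_map (by fun_prop) (by fun_prop)]
        rfl
    _ = infinitePi fun j => infinitePi fun k => μ.map (Y j k) := by
        rw [h.map_fun_eq_infinitePi_map fun p => hY p.1 p.2,
          infinitePi_map_piCurry fun j k => μ.map (Y j k)]
    _ = infinitePi fun j => μ.map fun ω k => Y j k ω := by simp only [hblock]

theorem iIndepFun_mul_of_injective {ε : ι → Ω → ℝ} (hε : ∀ e, Measurable (ε e))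
    (h : iIndepFun ε μ) {u v : J → ι} (hu : Function.Injective u) (hv : Function.Injective v)
    (huv : ∀ j k, u j ≠ v k) : iIndepFun (fun j => ε (u j) * ε (v j)) μ := by
  let g (p : (_ : J) × Bool) : ι := if p.2 then u p.1 else v p.1
  have hg : Function.Injective g := by
    rintro ⟨j, a⟩ ⟨k, b⟩ hjk
    cases a <;> cases b <;> simp_all [g, hu.eq_iff, hv.eq_iff, (huv _ _).symm]
  exact (iIndepFun_curry (Y := fun j a => ε (g ⟨j, a⟩)) (fun _ _ => hε _) (h.precomp hg)).comp
    (fun _ y => y true * y false) fun _ => by fun_prop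

theorem measureReal_abs_ge_le_of_hasSubgaussianMGF {Y : Ω → ℝ} {c : NNReal}
    (hY : HasSubgaussianMGF Y c μ) {t : ℝ} (ht : 0 ≤ t) :
    μ.real {ω | t ≤ |Y ω|} ≤ 2 * Real.exp (-t ^ 2 / (2 * c)) := by
  have hsplit : {ω | t ≤ |Y ω|} = {ω | t ≤ Y ω} ∪ {ω | t ≤ (-Y) ω} := by
    ext ω
    simp [le_abs]
  calc μ.real {ω | t ≤ |Y ω|} ≤ μ.real {ω | t ≤ Y ω} + μ.real {ω | t ≤ (-Y) ω} := by
        rw [hsplit]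
        exact measureReal_union_le _ _
    _ ≤ 2 * Real.exp (-t ^ 2 / (2 * c)) := by
        rw [two_mul]
        exact add_le_add (hY.measure_ge_le ht) (hY.neg.measure_ge_le ht)

theorem hasSubgaussianMGF_mono {Y : Ω → ℝ} {c c' : NNReal} (hY : HasSubgaussianMGF Y c μ)
    (hc : c ≤ c') : HasSubgaussianMGF Y c' μ where
  integrable_exp_mul := hY.integrable_exp_mul
  mgf_le t := (hY.mgf_le t).trans (by gcongr)

theorem measureReal_abs_sum_sub_integral_ge_le [Fintype J] {Y : J → Ω → ℝ}
    (hY : ∀ j, AEMeasurable (Y j) μ) (h : iIndepFun Y μ) (hb : ∀ j, ∀ᵐ ω ∂μ, |Y j ω| ≤ 1)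
    {N : ℕ} (hN : Fintype.card J ≤ N) {t : ℝ} (ht : 0 ≤ t) :
    μ.real {ω | t ≤ |∑ j, (Y j ω - μ[Y j])|} ≤ 2 * Real.exp (-t ^ 2 / (2 * N)) := by
  have := h.isProbabilityMeasure
  have hsub (j : J) : HasSubgaussianMGF (fun ω => Y j ω - μ[Y j]) 1 μ := by
    have hj := hasSubgaussianMGF_of_mem_Icc (hY j) ((hb j).mono fun ω => abs_le.1)
    norm_num at hj
    exact hj
  let center (j : J) (y : ℝ) : ℝ := y - μ[Y j]
  have hind : iIndepFun (fun j ω => Y j ω - μ[Y j]) μ :=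
    h.comp center fun _ => measurable_id.sub_const _
  have hsum := HasSubgaussianMGF.sum_of_iIndepFun hind (c := fun _ => 1) (s := Finset.univ)
    fun j _ => hsub j
  have hN' : ∑ _j : J, (1 : NNReal) ≤ (N : NNReal) := by simpa using hN
  exact measureReal_abs_ge_le_of_hasSubgaussianMGF (hasSubgaussianMGF_mono hsum hN') ht

end Hoeffding

section EdgeLaw

open Matrix unitInterval

/-- The edges of the complete graph on `Fin n`, each listed with its larger endpoint first. -/
abbrev Edge (n : ℕ) : Type := {e : Fin n × Fin n // e.2 < e.1}

variable {n : ℕ}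

/-- The edge between two distinct vertices, regardless of their order. -/
def edgeOfNe {i j : Fin n} (h : i ≠ j) : Edge n :=
  ⟨(max i j, min i j), min_lt_max.2 h⟩

theorem edgeOfNe_comm {i j : Fin n} (h : i ≠ j) : edgeOfNe h.symm = edgeOfNe h :=
  Subtype.ext (Prod.ext (max_comm j i) (min_comm j i))

theorem edgeOfNe_eq_iff {i j k l : Fin n} (h : i ≠ j) (h' : k ≠ l) :
    edgeOfNe h = edgeOfNe h' ↔ i = k ∧ j = l ∨ i = l ∧ j = k := by
  simp only [edgeOfNe, Subtype.mk.injEq, Prod.mk.injEq]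
  grind

theorem edgeOfNe_of_lt {e : Edge n} : edgeOfNe e.2.ne' = e :=
  Subtype.ext (Prod.ext (max_eq_left e.2.le) (min_eq_right e.2.le))

theorem prod_edge {M : Type*} [CommMonoid M] (f : Fin n → Fin n → M) :
    ∏ e : Edge n, f e.1.1 e.1.2 = ∏ i, ∏ j ∈ Finset.Iio i, f i j := by
  rw [← Finset.prod_subtype (Finset.univ.filter fun e : Fin n × Fin n => e.2 < e.1) (by simp)
    fun e => f e.1 e.2, Finset.prod_filter, Fintype.prod_prod_type]
  simp only [← Finset.prod_filter, Finset.filter_gt_eq_Iio]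

theorem apply_edgeOfNe {α : Type*} {a : Matrix (Fin n) (Fin n) α} (ha : a.IsSymm) {i j : Fin n}
    (h : i ≠ j) : a (edgeOfNe h).1.1 (edgeOfNe h).1.2 = a i j := by
  rcases h.lt_or_gt with hij | hji
  · simp [edgeOfNe, hij.le, ha.apply]
  · simp [edgeOfNe, hji.le]

/-- The adjacency matrix of the graph with the edge indicators `b`. -/
def adjOfEdges (b : Edge n → Bool) : Matrix (Fin n) (Fin n) ℝ :=
  Matrix.of fun i j => if h : i = j then 0 else if b (edgeOfNe h) then 1 else 0

theorem adjOfEdges_apply_of_ne (b : Edge n → Bool) {i j : Fin n} (h : i ≠ j) :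
    adjOfEdges b i j = if b (edgeOfNe h) then 1 else 0 := by
  simp [adjOfEdges, h]

theorem isAdjMatrix_adjOfEdges (b : Edge n → Bool) : (adjOfEdges b).IsAdjMatrix where
  zero_or_one i j := by
    simp only [adjOfEdges, of_apply]
    split_ifs <;> simp
  symm := by
    ext i j
    rcases eq_or_ne i j with rfl | h
    · rfl
    · rw [transpose_apply, adjOfEdges_apply_of_ne b h, adjOfEdges_apply_of_ne b h.symm,
        edgeOfNe_comm]
  apply_diag i := by simp [adjOfEdges]

/-- The edge indicators of the graph with adjacency matrix `a`. -/
noncomputable def edgesOfAdj (a : Matrix (Fin n) (Fin n) ℝ) (e : Edge n) : Bool :=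
  a e.1.1 e.1.2 = 1

theorem adjOfEdges_edgesOfAdj {a : Matrix (Fin n) (Fin n) ℝ} (ha : a.IsAdjMatrix) :
    adjOfEdges (edgesOfAdj a) = a := by
  ext i j
  rcases eq_or_ne i j with rfl | h
  · simp [adjOfEdges, ha.apply_diag i]
  · rw [adjOfEdges_apply_of_ne _ h, edgesOfAdj, apply_edgeOfNe ha.symm]
    rcases ha.zero_or_one i j with h0 | h1 <;> simp [*]

theorem edgesOfAdj_adjOfEdges (b : Edge n → Bool) : edgesOfAdj (adjOfEdges b) = b := by
  ext e
  simp [edgesOfAdj, adjOfEdges_apply_of_ne b e.2.ne', edgeOfNe_of_lt]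

/-- The probability `P i j` of the edge between `i > j` as a point of `[0, 1]`; a value outside this
interval is projected to it, so that `edgeLaw` is always a probability measure. -/
noncomputable def edgeProb (P : Matrix (Fin n) (Fin n) ℝ) (e : Edge n) : I :=
  Set.projIcc 0 1 zero_le_one (P e.1.1 e.1.2)

theorem coe_edgeProb {P : Matrix (Fin n) (Fin n) ℝ} (hP : ∀ i j, P i j ∈ Set.Icc (0 : ℝ) 1)
    (e : Edge n) : (edgeProb P e : ℝ) = P e.1.1 e.1.2 := by
  rw [edgeProb, Set.projIcc_of_mem _ (hP _ _)]

/-- The law of the edge indicators of a random graph with independent edges in which `P i j` is the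
probability of an edge between `i > j`. -/
noncomputable def edgeLaw (P : Matrix (Fin n) (Fin n) ℝ) : Measure (Edge n → Bool) :=
  Measure.pi fun e => bernoulliMeasure true false (edgeProb P e)

instance (P : Matrix (Fin n) (Fin n) ℝ) : IsProbabilityMeasure (edgeLaw P) := by
  unfold edgeLaw
  infer_instance

variable {P : Matrix (Fin n) (Fin n) ℝ}

theorem edgeLaw_real_singleton (hP : ∀ i j, P i j ∈ Set.Icc (0 : ℝ) 1) (b : Edge n → Bool) :
    (edgeLaw P).real {b} = ∏ i, ∏ j ∈ Finset.Iio i,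
      if adjOfEdges b i j = 1 then P i j else 1 - P i j := by
  rw [← prod_edge fun i j => if adjOfEdges b i j = 1 then P i j else 1 - P i j, edgeLaw,
    measureReal_def, Measure.pi_singleton, ENNReal.toReal_prod]
  refine Finset.prod_congr rfl fun e _ => ?_
  rw [← measureReal_def, adjOfEdges_apply_of_ne b e.2.ne', edgeOfNe_of_lt,
    bernoulliMeasure_real_apply _ (measurableSet_singleton _)]
  cases b e <;> simp [coe_edgeProb hP]

/-- The deviation of an edge indicator from its mean. -/
def edgeNoise (P : Matrix (Fin n) (Fin n) ℝ) (e : Edge n) (b : Edge n → Bool) : ℝ :=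
  (if b e then 1 else 0) - P e.1.1 e.1.2

theorem centeredAdj_adjOfEdges_of_ne (hP : P.IsSymm) (b : Edge n → Bool) {i j : Fin n}
    (h : i ≠ j) : centeredAdj (adjOfEdges b) P i j = edgeNoise P (edgeOfNe h) b := by
  rw [centeredAdj_apply_of_ne h, adjOfEdges_apply_of_ne b h, edgeNoise, apply_edgeOfNe hP]

theorem measurable_edgeNoise (e : Edge n) : Measurable (edgeNoise P e) :=
  measurable_of_countable _

theorem iIndepFun_edgeNoise : iIndepFun (edgeNoise P) (edgeLaw P) :=
  iIndepFun_pi (X := fun (e : Edge n) (c : Bool) => (if c then (1 : ℝ) else 0) - P e.1.1 e.1.2)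
    fun _ => (measurable_of_countable _).aemeasurable

theorem integral_edgeNoise (hP : ∀ i j, P i j ∈ Set.Icc (0 : ℝ) 1) (e : Edge n) :
    ∫ b, edgeNoise P e b ∂edgeLaw P = 0 := by
  have hcoord : ∫ b, edgeNoise P e b ∂edgeLaw P =
      ∫ c, ((if c then 1 else 0) - P e.1.1 e.1.2) ∂bernoulliMeasure true false (edgeProb P e) :=
    integral_comp_eval (μ := fun e => bernoulliMeasure true false (edgeProb P e))
      (f := fun c : Bool => (if c then 1 else 0) - P e.1.1 e.1.2)
      (measurable_of_countable _).aestronglyMeasurable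
  rw [hcoord, integral_bernoulliMeasure, coe_edgeProb hP]
  simp only [if_true, Bool.false_eq_true, if_false, smul_eq_mul]
  ring

theorem abs_edgeNoise_le_one (hP : ∀ i j, P i j ∈ Set.Icc (0 : ℝ) 1) (e : Edge n)
    (b : Edge n → Bool) : |edgeNoise P e b| ≤ 1 := by
  obtain ⟨h0, h1⟩ := hP e.1.1 e.1.2
  rw [edgeNoise, abs_le]
  split_ifs <;> constructor <;> linarith

end EdgeLaw

section EdgeTail

open Matrix

variable {n : ℕ} {P : Matrix (Fin n) (Fin n) ℝ}

theorem centeredAdj_adjOfEdges_mulVec (hP : P.IsSymm) (b : Edge n → Bool) (w : Fin n → ℝ)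
    (i : Fin n) : (centeredAdj (adjOfEdges b) P *ᵥ w) i =
      ∑ j : {j // i ≠ j}, edgeNoise P (edgeOfNe j.2) b * w j := by
  rw [show (centeredAdj (adjOfEdges b) P *ᵥ w) i =
    ∑ j, centeredAdj (adjOfEdges b) P i j * w j from rfl]
  symm
  refine Fintype.sum_of_injective _ Subtype.val_injective _ _ (fun j hj => ?_) fun j => ?_
  · obtain rfl : i = j := by simpa using hj
    rw [centeredAdj_apply_self, zero_mul]
  · rw [centeredAdj_adjOfEdges_of_ne hP b j.2]

theorem centeredAdj_adjOfEdges_mul_self (hP : P.IsSymm) (b : Edge n → Bool) (i j : Fin n) :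
    (centeredAdj (adjOfEdges b) P * centeredAdj (adjOfEdges b) P) i j =
      ∑ k : {k // i ≠ k ∧ k ≠ j},
        edgeNoise P (edgeOfNe k.2.1) b * edgeNoise P (edgeOfNe k.2.2) b := by
  rw [mul_apply]
  symm
  refine Fintype.sum_of_injective _ Subtype.val_injective _ _ (fun k hk => ?_) fun k => ?_
  · obtain rfl | rfl : i = k ∨ k = j := by simpa [imp_iff_not_or] using hk
    · rw [centeredAdj_apply_self, zero_mul]
    · rw [centeredAdj_apply_self, mul_zero]
  · rw [centeredAdj_adjOfEdges_of_ne hP b k.2.1, centeredAdj_adjOfEdges_of_ne hP b k.2.2]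

theorem edgeLaw_abs_centeredAdj_mulVec_ge_le (hP : ∀ i j, P i j ∈ Set.Icc (0 : ℝ) 1)
    (hPsymm : P.IsSymm) {w : Fin n → ℝ} (hw : ∀ j, |w j| ≤ 1) (i : Fin n) {t : ℝ} (ht : 0 ≤ t) :
    (edgeLaw P).real {b | t ≤ |(centeredAdj (adjOfEdges b) P *ᵥ w) i|} ≤
      2 * Real.exp (-t ^ 2 / (2 * n)) := by
  let edge (j : {j // i ≠ j}) : Edge n := edgeOfNe j.2
  let Y (j : {j // i ≠ j}) (b : Edge n → Bool) : ℝ := edgeNoise P (edge j) b * w j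
  have hedge : Function.Injective edge := fun j k hjk =>
    Subtype.ext (by grind [(edgeOfNe_eq_iff j.2 k.2).1 hjk])
  have hind : iIndepFun Y (edgeLaw P) := (iIndepFun_edgeNoise.precomp hedge).comp
    (fun j y => y * w j) fun j => by fun_prop
  have hbound (j) : ∀ᵐ b ∂edgeLaw P, |Y j b| ≤ 1 := ae_of_all _ fun b => by
    rw [abs_mul]
    exact mul_le_one₀ (abs_edgeNoise_le_one hP _ b) (abs_nonneg _) (hw j)
  have hmean (j) : ∫ b, Y j b ∂edgeLaw P = 0 := by
    rw [integral_mul_const, integral_edgeNoise hP, zero_mul]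
  have hsum (b) : ∑ j, (Y j b - ∫ b, Y j b ∂edgeLaw P) =
      (centeredAdj (adjOfEdges b) P *ᵥ w) i := by
    simp only [hmean, sub_zero, centeredAdj_adjOfEdges_mulVec hPsymm, Y, edge]
  simpa only [hsum] using measureReal_abs_sum_sub_integral_ge_le
    (fun j => (measurable_of_countable (Y j)).aemeasurable) hind hbound (N := n)
    ((Fintype.card_subtype_le _).trans_eq (Fintype.card_fin n)) ht

theorem edgeLaw_abs_centeredAdj_mul_self_ge_le (hP : ∀ i j, P i j ∈ Set.Icc (0 : ℝ) 1)
    (hPsymm : P.IsSymm) {i j : Fin n} (hij : i ≠ j) {t : ℝ} (ht : 0 ≤ t) :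
    (edgeLaw P).real {b | t ≤
      |(centeredAdj (adjOfEdges b) P * centeredAdj (adjOfEdges b) P) i j|} ≤
      2 * Real.exp (-t ^ 2 / (2 * n)) := by
  let left (k : {k // i ≠ k ∧ k ≠ j}) : Edge n := edgeOfNe k.2.1
  let right (k : {k // i ≠ k ∧ k ≠ j}) : Edge n := edgeOfNe k.2.2
  have hleft : Function.Injective left := fun k l hkl =>
    Subtype.ext (by grind [(edgeOfNe_eq_iff k.2.1 l.2.1).1 hkl])
  have hright : Function.Injective right := fun k l hkl =>
    Subtype.ext (by grind [(edgeOfNe_eq_iff k.2.2 l.2.2).1 hkl])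
  have hne (k l) : left k ≠ right l := fun hkl => by
    grind [(edgeOfNe_eq_iff k.2.1 l.2.2).1 hkl]
  let Y (k) : (Edge n → Bool) → ℝ := edgeNoise P (left k) * edgeNoise P (right k)
  have hind : iIndepFun Y (edgeLaw P) :=
    iIndepFun_mul_of_injective measurable_edgeNoise iIndepFun_edgeNoise hleft hright hne
  have hbound (k) : ∀ᵐ b ∂edgeLaw P, |Y k b| ≤ 1 := ae_of_all _ fun b => by
    rw [show Y k b = edgeNoise P (left k) b * edgeNoise P (right k) b from rfl, abs_mul]
    exact mul_le_one₀ (abs_edgeNoise_le_one hP _ b) (abs_nonneg _) (abs_edgeNoise_le_one hP _ b)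
  have hmean (k) : ∫ b, Y k b ∂edgeLaw P = 0 := by
    rw [(iIndepFun_edgeNoise.indepFun (hne k k)).integral_mul_eq_mul_integral
      (measurable_edgeNoise _).aestronglyMeasurable (measurable_edgeNoise _).aestronglyMeasurable,
      integral_edgeNoise hP, zero_mul]
  have hsum (b) : ∑ k, (Y k b - ∫ b, Y k b ∂edgeLaw P) =
      (centeredAdj (adjOfEdges b) P * centeredAdj (adjOfEdges b) P) i j := by
    simp only [hmean, sub_zero, centeredAdj_adjOfEdges_mul_self hPsymm]
    rfl
  simpa only [hsum] using measureReal_abs_sum_sub_integral_ge_le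
    (fun k => (measurable_of_countable (Y k)).aemeasurable) hind hbound (N := n)
    ((Fintype.card_subtype_le _).trans_eq (Fintype.card_fin n)) ht

end EdgeTail

section CondDistrib

variable {Ω E β : Type*} [MeasurableSpace Ω] [MeasurableSpace E] [MeasurableSpace β]
  [StandardBorelSpace β] [Nonempty β] {μ : Measure Ω} {X : Ω → E} {B : Ω → β}

theorem ae_condDistrib_eq_of_condProb_singleton_eq [Countable β] [IsFiniteMeasure μ]
    (hX : Measurable X) (hB : Measurable B) {ν : Ω → Measure β} [∀ ω, IsFiniteMeasure (ν ω)]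
    (hν : ∀ b, μ⟦B ⁻¹' {b} | MeasurableSpace.comap X inferInstance⟧ =ᵐ[μ]
      fun ω => (ν ω).real {b}) :
    ∀ᵐ ω ∂μ, condDistrib B X μ (X ω) = ν ω := by
  have hsingleton : ∀ᵐ ω ∂μ, ∀ b, (condDistrib B X μ (X ω)).real {b} = (ν ω).real {b} :=
    ae_all_iff.2 fun b =>
      (condDistrib_ae_eq_condExp hX hB (measurableSet_singleton b)).trans (hν b)
  filter_upwards [hsingleton] with ω hω using Measure.ext_of_measureReal_singleton hω

theorem measureReal_le_of_ae_condDistrib_le [IsProbabilityMeasure μ]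
    (hX : Measurable X) (hB : Measurable B) {D : Set (E × β)} (hD : MeasurableSet D) {δ : ℝ}
    (hδ : ∀ᵐ ω ∂μ, (condDistrib B X μ (X ω)).real (Prod.mk (X ω) ⁻¹' D) ≤ δ) :
    μ.real {ω | (X ω, B ω) ∈ D} ≤ δ := by
  have hδ0 : 0 ≤ δ := hδ.exists.elim fun ω hω => measureReal_nonneg.trans hω
  refine ENNReal.toReal_le_of_le_ofReal hδ0 ?_
  calc μ {ω | (X ω, B ω) ∈ D} = μ.map (fun ω => (X ω, B ω)) D :=
        (Measure.map_apply (hX.prodMk hB) hD).symm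
    _ = ∫⁻ ω, condDistrib B X μ (X ω) (Prod.mk (X ω) ⁻¹' D) ∂μ := by
        rw [← compProd_map_condDistrib hB.aemeasurable, Measure.compProd_apply hD,
          lintegral_map (Kernel.measurable_kernel_prodMk_left hD) hX]
    _ ≤ ∫⁻ _, ENNReal.ofReal δ ∂μ := by
        refine lintegral_mono_ae (hδ.mono fun ω hω => ?_)
        exact (ENNReal.le_ofReal_iff_toReal_le (measure_ne_top _ _) hδ0).2 hω
    _ = ENNReal.ofReal δ := by simp

end CondDistrib

section RandomGraph

open Matrix

theorem positionMatrix_mul_transpose_apply {d n : ℕ} {Ω : Type*}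
    (X : Fin n → Ω → EuclideanSpace ℝ (Fin d)) (ω : Ω) (i j : Fin n) :
    (positionMatrix X ω * (positionMatrix X ω)ᵀ) i j = ⟪X i ω, X j ω⟫ := by
  simp [mul_apply, positionMatrix, PiLp.inner_apply, mul_comm]

theorem measurable_centeredAdj_mul_transpose {d n : ℕ} (a : Matrix (Fin n) (Fin n) ℝ)
    (i j : Fin n) : Measurable fun x : Fin n → EuclideanSpace ℝ (Fin d) =>
      centeredAdj a (of (fun i k => x i k) * (of fun i k => x i k)ᵀ) i j := by
  by_cases hij : i = j
  · simp [centeredAdj, hij]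
  · simp only [centeredAdj, hij, if_false, of_apply, mul_apply, transpose_apply]
    fun_prop

variable {d n : ℕ} {Ω : Type*} [MeasurableSpace Ω] {F : Measure (EuclideanSpace ℝ (Fin d))}
  {μ : Measure Ω} {X : Fin n → Ω → EuclideanSpace ℝ (Fin d)} {A : Ω → Matrix (Fin n) (Fin n) ℝ}

theorem IsLatentDistribution.ae_abs_apply_le_one (hF : IsLatentDistribution F) :
    ∀ᵐ x ∂F, ∀ k, |x k| ≤ 1 := by
  obtain ⟨-, S, hS, hmem⟩ := hF
  filter_upwards [hmem] with x hx k
  have hnorm : ‖x‖ ≤ 1 := by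
    rw [← sq_le_one_iff₀ (norm_nonneg x), ← real_inner_self_eq_norm_sq]
    exact (hS x hx x hx).2
  exact (PiLp.norm_apply_le x k).trans hnorm

namespace IsRDPG

theorem ae_of_ae (h : IsRDPG F μ X A) {p : EuclideanSpace ℝ (Fin d) → Prop} (hp : ∀ᵐ x ∂F, p x) :
    ∀ᵐ ω ∂μ, ∀ i, p (X i ω) :=
  ae_all_iff.2 fun i =>
    ae_of_ae_map (h.measurable_position i).aemeasurable (by rwa [h.map_position i])

theorem ae_inner_mem_Icc (h : IsRDPG F μ X A) (hF : IsLatentDistribution F) :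
    ∀ᵐ ω ∂μ, ∀ i j, (positionMatrix X ω * (positionMatrix X ω)ᵀ) i j ∈ Set.Icc (0 : ℝ) 1 := by
  obtain ⟨-, S, hS, hmem⟩ := hF
  filter_upwards [h.ae_of_ae hmem] with ω hω i j
  rw [positionMatrix_mul_transpose_apply]
  exact hS _ (hω i) _ (hω j)

theorem measurable_edgesOfAdj (h : IsRDPG F μ X A) : Measurable fun ω => edgesOfAdj (A ω) :=
  measurable_pi_iff.2 fun e => measurable_to_bool <| by
    simpa [Set.preimage, edgesOfAdj] using
      h.measurable_entry e.1.1 e.1.2 (measurableSet_singleton 1)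

theorem ae_condDistrib_edgesOfAdj_eq [IsFiniteMeasure μ] (h : IsRDPG F μ X A)
    (hF : IsLatentDistribution F) :
    ∀ᵐ ω ∂μ, condDistrib (fun ω => edgesOfAdj (A ω)) (fun ω i => X i ω) μ (fun i => X i ω) =
      edgeLaw (positionMatrix X ω * (positionMatrix X ω)ᵀ) := by
  refine ae_condDistrib_eq_of_condProb_singleton_eq (measurable_pi_iff.2 h.measurable_position)
    h.measurable_edgesOfAdj fun b => ?_
  have hpre : (fun ω => edgesOfAdj (A ω)) ⁻¹' {b} = {ω | A ω = adjOfEdges b} := by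
    ext ω
    refine ⟨fun hω => ?_, fun hω => ?_⟩
    · rw [Set.mem_ofPred_eq, ← adjOfEdges_edgesOfAdj (h.isAdjMatrix ω)]
      exact congrArg adjOfEdges hω
    · exact (congrArg edgesOfAdj hω).trans (edgesOfAdj_adjOfEdges b)
  rw [hpre]
  filter_upwards [h.condProb_eq _ (isAdjMatrix_adjOfEdges b), h.ae_inner_mem_Icc hF] with ω hω hP
  rw [hω, edgeLaw_real_singleton hP]
  simp only [positionMatrix_mul_transpose_apply]

theorem measureReal_ge_le_of_edgeLaw_ge_le [IsProbabilityMeasure μ] (h : IsRDPG F μ X A)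
    (hF : IsLatentDistribution F) {f : Matrix (Fin n) (Fin d) ℝ → Matrix (Fin n) (Fin n) ℝ → ℝ}
    (hf : ∀ a, Measurable fun x : Fin n → EuclideanSpace ℝ (Fin d) => f (.of fun i k => x i k) a)
    {t δ : ℝ} (hδ : ∀ᵐ ω ∂μ, (edgeLaw (positionMatrix X ω * (positionMatrix X ω)ᵀ)).real
      {b | t ≤ f (positionMatrix X ω) (adjOfEdges b)} ≤ δ) :
    μ.real {ω | t ≤ f (positionMatrix X ω) (A ω)} ≤ δ := by
  let D : Set ((Fin n → EuclideanSpace ℝ (Fin d)) × (Edge n → Bool)) :=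
    {p | t ≤ f (.of fun i k => p.1 i k) (adjOfEdges p.2)}
  have hD : MeasurableSet D :=
    measurableSet_le measurable_const <|
      measurable_from_prod_countable_left fun b => hf (adjOfEdges b)
  have hset : {ω | t ≤ f (positionMatrix X ω) (A ω)} =
      {ω | ((fun i => X i ω), edgesOfAdj (A ω)) ∈ D} := by
    ext ω
    simp only [D, Set.mem_ofPred_eq, adjOfEdges_edgesOfAdj (h.isAdjMatrix ω)]
    rfl
  rw [hset]
  refine measureReal_le_of_ae_condDistrib_le (measurable_pi_iff.2 h.measurable_position)
    h.measurable_edgesOfAdj hD ?_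
  filter_upwards [h.ae_condDistrib_edgesOfAdj_eq hF, hδ] with ω hω hle
  rw [hω]
  exact hle

theorem measureReal_abs_noise_mul_ge_le [IsProbabilityMeasure μ] (h : IsRDPG F μ X A)
    (hF : IsLatentDistribution F) (i : Fin n) (k : Fin d) {t : ℝ} (ht : 0 ≤ t) :
    μ.real {ω | t ≤ |(centeredAdj (A ω) (positionMatrix X ω * (positionMatrix X ω)ᵀ) *
      positionMatrix X ω) i k|} ≤ 2 * Real.exp (-t ^ 2 / (2 * n)) := by
  refine h.measureReal_ge_le_of_edgeLaw_ge_le hF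
    (f := fun x a => |(centeredAdj a (x * xᵀ) * x) i k|) (fun a => ?_) ?_
  · simp only [mul_apply (M := centeredAdj _ _)]
    have := measurable_centeredAdj_mul_transpose (d := d) a
    fun_prop
  · filter_upwards [h.ae_inner_mem_Icc hF, h.ae_of_ae hF.ae_abs_apply_le_one] with ω hP hw
    have hsymm : (positionMatrix X ω * (positionMatrix X ω)ᵀ).IsSymm := by
      rw [IsSymm, transpose_mul, transpose_transpose]
    exact edgeLaw_abs_centeredAdj_mulVec_ge_le hP hsymm
      (fun j => hw j k) i ht

theorem measureReal_abs_noise_sq_ge_le [IsProbabilityMeasure μ] (h : IsRDPG F μ X A)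
    (hF : IsLatentDistribution F) {i j : Fin n} (hij : i ≠ j) {t : ℝ} (ht : 0 ≤ t) :
    μ.real {ω | t ≤ |(centeredAdj (A ω) (positionMatrix X ω * (positionMatrix X ω)ᵀ) *
      centeredAdj (A ω) (positionMatrix X ω * (positionMatrix X ω)ᵀ)) i j|} ≤
      2 * Real.exp (-t ^ 2 / (2 * n)) := by
  refine h.measureReal_ge_le_of_edgeLaw_ge_le hF
    (f := fun x a => |(centeredAdj a (x * xᵀ) * centeredAdj a (x * xᵀ)) i j|) (fun a => ?_) ?_
  · simp only [mul_apply (M := centeredAdj _ _)]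
    have := measurable_centeredAdj_mul_transpose (d := d) a
    fun_prop
  · filter_upwards [h.ae_inner_mem_Icc hF] with ω hP
    have hsymm : (positionMatrix X ω * (positionMatrix X ω)ᵀ).IsSymm := by
      rw [IsSymm, transpose_mul, transpose_transpose]
    exact edgeLaw_abs_centeredAdj_mul_self_ge_le hP hsymm hij ht

theorem integral_apply_mul_apply (h : IsRDPG F μ X A) (i : Fin n) (k l : Fin d) :
    ∫ ω, X i ω k * X i ω l ∂μ = secondMoment F k l := by
  rw [secondMoment, of_apply, ← h.map_position i]
  exact (integral_map (h.measurable_position i).aemeasurable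
    (f := fun x : EuclideanSpace ℝ (Fin d) => x k * x l)
    (by fun_prop)).symm

theorem measureReal_abs_gram_sub_ge_le (h : IsRDPG F μ X A) (hF : IsLatentDistribution F)
    (k l : Fin d) {t : ℝ} (ht : 0 ≤ t) :
    μ.real {ω | t ≤ |((positionMatrix X ω)ᵀ * positionMatrix X ω - (n : ℝ) • secondMoment F) k l|} ≤
      2 * Real.exp (-t ^ 2 / (2 * n)) := by
  have hind : iIndepFun (fun i ω => X i ω k * X i ω l) μ :=
    h.indep.comp (fun _ x => x k * x l) fun _ => by fun_prop
  have hbound (i) : ∀ᵐ ω ∂μ, |X i ω k * X i ω l| ≤ 1 := by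
    filter_upwards [h.ae_of_ae hF.ae_abs_apply_le_one] with ω hω
    rw [abs_mul]
    exact mul_le_one₀ (hω i k) (abs_nonneg _) (hω i l)
  have hmeas (i) : AEMeasurable (fun ω => X i ω k * X i ω l) μ := by
    have := h.measurable_position i
    fun_prop
  have hsum (ω) : ((positionMatrix X ω)ᵀ * positionMatrix X ω - (n : ℝ) • secondMoment F) k l =
      ∑ i, (X i ω k * X i ω l - ∫ ω, X i ω k * X i ω l ∂μ) := by
    simp [h.integral_apply_mul_apply, mul_apply, positionMatrix]
  simpa only [hsum] using
    measureReal_abs_sum_sub_integral_ge_le hmeas hind hbound (Fintype.card_fin n).le ht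

end IsRDPG

end RandomGraph

theorem measureReal_exists_le {Ω ι : Type*} [MeasurableSpace Ω] {μ : Measure Ω} [Fintype ι]
    {p : ι → Ω → Prop} {δ : ℝ} (h : ∀ i, μ.real {ω | p i ω} ≤ δ) :
    μ.real {ω | ∃ i, p i ω} ≤ Fintype.card ι * δ := by
  rw [Set.ofPred_exists]
  calc μ.real (⋃ i, {ω | p i ω}) ≤ ∑ i, μ.real {ω | p i ω} := measureReal_iUnion_fintype_le _
    _ ≤ ∑ _i : ι, δ := Finset.sum_le_sum fun i _ => h i
    _ = Fintype.card ι * δ := by simp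

theorem IsRDPG.measureReal_not_isConcentrated_le {d n : ℕ} {Ω : Type*} [MeasurableSpace Ω]
    {F : Measure (EuclideanSpace ℝ (Fin d))} {μ : Measure Ω} [IsProbabilityMeasure μ]
    {X : Fin n → Ω → EuclideanSpace ℝ (Fin d)} {A : Ω → Matrix (Fin n) (Fin n) ℝ}
    (h : IsRDPG F μ X A) (hF : IsLatentDistribution F) {t : ℝ} (ht : 0 ≤ t) :
    μ.real {ω | ¬ IsConcentrated (secondMoment F) t (A ω) (positionMatrix X ω)} ≤
      2 * (n * d + n * n + d * d) * Real.exp (-t ^ 2 / (2 * n)) := by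
  let Y := positionMatrix X
  let E ω := centeredAdj (A ω) (Y ω * (Y ω)ᵀ)
  let N₁ : Set Ω := {ω | ∃ p : Fin n × Fin d, t ≤ |(E ω * Y ω) p.1 p.2|}
  let N₂ : Set Ω := {ω | ∃ p : Fin n × Fin n, p.1 ≠ p.2 ∧ t ≤ |(E ω * E ω) p.1 p.2|}
  let N₃ : Set Ω :=
    {ω | ∃ p : Fin d × Fin d, t ≤ |((Y ω)ᵀ * Y ω - (n : ℝ) • secondMoment F) p.1 p.2|}
  have hcover : ∀ᵐ ω ∂μ, ¬ IsConcentrated (secondMoment F) t (A ω) (Y ω) → ω ∈ N₁ ∪ N₂ ∪ N₃ := by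
    filter_upwards [h.ae_inner_mem_Icc hF] with ω hP
    contrapose!
    simp only [N₁, N₂, N₃, Set.mem_union, Set.mem_ofPred_eq, Prod.exists, not_or, not_exists,
      not_and, not_le]
    rintro ⟨⟨h₁, h₂⟩, h₃⟩
    exact ⟨h.isAdjMatrix ω, hP, fun i k => (h₁ i k).le, fun i j hij => (h₂ i j hij).le,
      fun k l => (h₃ k l).le⟩
  have hN₁ : μ.real N₁ ≤ _ := measureReal_exists_le fun p =>
    h.measureReal_abs_noise_mul_ge_le hF p.1 p.2 ht
  have hN₂ : μ.real N₂ ≤ Fintype.card (Fin n × Fin n) * (2 * Real.exp (-t ^ 2 / (2 * n))) :=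
    measureReal_exists_le fun p => by
      by_cases hp : p.1 = p.2
      · simp only [hp, ne_eq, not_true_eq_false, false_and, Set.ofPred_false, measureReal_empty]
        positivity
      · simpa only [ne_eq, hp, not_false_eq_true, true_and] using
          h.measureReal_abs_noise_sq_ge_le hF hp ht
  have hN₃ : μ.real N₃ ≤ _ := measureReal_exists_le fun p =>
    h.measureReal_abs_gram_sub_ge_le hF p.1 p.2 ht
  simp only [Fintype.card_prod, Fintype.card_fin, Nat.cast_mul] at hN₁ hN₂ hN₃
  calc μ.real {ω | ¬ IsConcentrated (secondMoment F) t (A ω) (Y ω)}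
      ≤ μ.real (N₁ ∪ N₂ ∪ N₃) := ENNReal.toReal_mono (measure_ne_top μ _) (measure_mono_ae hcover)
    _ ≤ μ.real N₁ + μ.real N₂ + μ.real N₃ :=
      (measureReal_union_le _ _).trans (by gcongr; exact measureReal_union_le _ _)
    _ ≤ _ := by linarith

section SecondMoment

open Matrix

variable {d : ℕ} {F : Measure (EuclideanSpace ℝ (Fin d))}

theorem IsLatentDistribution.integrable_apply_mul_apply (hF : IsLatentDistribution F)
    (k l : Fin d) : Integrable (fun x : EuclideanSpace ℝ (Fin d) => x k * x l) F := by
  have := hF.1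
  refine .of_bound (by fun_prop) 1 ?_
  filter_upwards [hF.ae_abs_apply_le_one] with x hx
  rw [Real.norm_eq_abs, abs_mul]
  exact mul_le_one₀ (hx k) (abs_nonneg _) (hx l)

theorem IsLatentDistribution.dotProduct_secondMoment_mulVec (hF : IsLatentDistribution F)
    (z : Fin d → ℝ) :
    z ⬝ᵥ secondMoment F *ᵥ z = ∫ x : EuclideanSpace ℝ (Fin d), (∑ k, z k * x k) ^ 2 ∂F := by
  have hsq (x : EuclideanSpace ℝ (Fin d)) :
      (∑ k, z k * x k) ^ 2 = ∑ k, ∑ l, z k * z l * (x k * x l) := by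
    rw [sq, Finset.sum_mul_sum]
    exact Finset.sum_congr rfl fun k _ => Finset.sum_congr rfl fun l _ => mul_mul_mul_comm ..
  have hint (k l) : Integrable (fun x : EuclideanSpace ℝ (Fin d) => z k * z l * (x k * x l)) F :=
    (hF.integrable_apply_mul_apply k l).const_mul _
  simp only [hsq, integral_finsetSum _ fun k _ => integrable_finsetSum _ fun l _ => hint k l,
    integral_finsetSum _ fun l _ => hint _ l, integral_const_mul, dotProduct, mulVec,
    secondMoment, of_apply, Finset.mul_sum]
  exact Finset.sum_congr rfl fun k _ => Finset.sum_congr rfl fun l _ => by ring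

theorem IsLatentDistribution.posSemidef_secondMoment (hF : IsLatentDistribution F) :
    (secondMoment F).PosSemidef := by
  refine .of_dotProduct_mulVec_nonneg (Matrix.ext fun k l => ?_) fun z => ?_
  · simp [secondMoment, mul_comm]
  · rw [star_trivial, hF.dotProduct_secondMoment_mulVec]
    exact integral_nonneg fun x => sq_nonneg _

theorem isUnit_of_rank_eq_card {K m : Type*} [Field K] [Fintype m] [DecidableEq m]
    {H : Matrix m m K} (hH : H.rank = Fintype.card m) : IsUnit H :=
  mulVec_surjective_iff_isUnit.1 <| (LinearMap.range_eq_top (f := H.mulVecLin)).1 <|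
    Submodule.eq_top_of_finrank_eq (by rw [Module.finrank_fintype_fun_eq_card, ← hH, rank])

open scoped MatrixOrder in
theorem exists_mul_norm_sq_le_inner_of_posDef {m : Type*} [Fintype m] [DecidableEq m]
    {H : Matrix m m ℝ} (hH : H.PosDef) :
    ∃ r > 0, ∀ z : EuclideanSpace ℝ m, r * ‖z‖ ^ 2 ≤ ⟪H.toEuclideanLin z, z⟫ := by
  cases isEmpty_or_nonempty m
  · exact ⟨1, one_pos, fun z => by simp [Subsingleton.elim z 0]⟩
  obtain ⟨r, hr, hle⟩ := (CFC.exists_pos_algebraMap_le_iff hH.isHermitian).2 fun _ hx =>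
    hH.isStrictlyPositive.spectrum_pos hx
  refine ⟨r, hr, fun z => ?_⟩
  have h := (isPositive_toEuclideanLin_iff.2 (le_iff.1 hle)).2 z
  simpa [Algebra.algebraMap_eq_smul_one, inner_sub_left, inner_smul_left] using h

theorem IsLatentDistribution.exists_mul_norm_sq_le_inner_secondMoment
    (hF : IsLatentDistribution F) (hrank : (secondMoment F).rank = d) :
    ∃ κ, 0 < κ ∧ κ ≤ 1 ∧ ∀ z, 4 * κ * ‖z‖ ^ 2 ≤ ⟪(secondMoment F).toEuclideanLin z, z⟫ := by
  obtain ⟨r, hr, hle⟩ := exists_mul_norm_sq_le_inner_of_posDef <|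
    hF.posSemidef_secondMoment.posDef_iff_isUnit.2 <|
      isUnit_of_rank_eq_card (hrank.trans (Fintype.card_fin d).symm)
  refine ⟨min 1 (r / 4), by positivity, min_le_left _ _, fun z => (hle z).trans' ?_⟩
  gcongr
  linarith [min_le_right 1 (r / 4)]

end SecondMoment

section Asymptotics

open Filter

theorem tendsto_log_natCast_atTop : Tendsto (fun n : ℕ => Real.log n) atTop atTop :=
  Real.tendsto_log_atTop.comp tendsto_natCast_atTop_atTop

theorem eventually_mul_sqrt_log_le (K : ℝ) : ∀ᶠ n : ℕ in atTop, K * √(Real.log n) ≤ √n := by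
  have hlog := Real.isLittleO_log_id_atTop.comp_tendsto tendsto_natCast_atTop_atTop
  filter_upwards [hlog.def (c := (K ^ 2 + 1)⁻¹) (by positivity)] with n hn
  have hn' : Real.log n ≤ (K ^ 2 + 1)⁻¹ * n := by
    simpa using (le_abs_self _).trans hn
  refine Real.le_sqrt_of_sq_le ?_
  rw [mul_pow, Real.sq_sqrt (Real.log_natCast_nonneg n)]
  rw [le_inv_mul_iff₀ (by positivity)] at hn'
  linarith [Real.log_natCast_nonneg n]

theorem sqrt_mul_mul_log_add_one_le {a : ℝ} (ha : 0 ≤ a) {n : ℕ} (hn : 1 ≤ Real.log n) :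
    √(a * n * Real.log n) + 1 ≤ (√a + 1) * (√n * √(Real.log n)) := by
  have hn1 : (1 : ℝ) ≤ n := by
    have : n ≠ 0 := by rintro rfl; simp at hn; linarith
    exact_mod_cast Nat.one_le_iff_ne_zero.2 this
  have h1 : 1 ≤ √n * √(Real.log n) :=
    one_le_mul_of_one_le_of_one_le (Real.one_le_sqrt.2 hn1) (Real.one_le_sqrt.2 hn)
  rw [mul_assoc, Real.sqrt_mul ha, Real.sqrt_mul (Nat.cast_nonneg n), add_mul, one_mul]
  gcongr

theorem eventually_mul_sqrt_mul_log_add_one_le {a K : ℝ} (ha : 0 ≤ a) (hK : 0 ≤ K) :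
    ∀ᶠ n : ℕ in atTop, K * (√(a * n * Real.log n) + 1) ≤ n := by
  filter_upwards [tendsto_log_natCast_atTop.eventually_ge_atTop 1,
    eventually_mul_sqrt_log_le (K * (√a + 1))] with n hlog hn
  calc K * (√(a * n * Real.log n) + 1) ≤ K * ((√a + 1) * (√n * √(Real.log n))) := by
        gcongr; exact sqrt_mul_mul_log_add_one_le ha hlog
    _ = √n * (K * (√a + 1) * √(Real.log n)) := by ring
    _ ≤ √n * √n := by gcongr
    _ = n := Real.mul_self_sqrt (Nat.cast_nonneg n)

theorem eventually_mul_sqrt_mul_log_add_one_div_le {a K : ℝ} (ha : 0 ≤ a) (hK : 0 ≤ K)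
    {b : ℕ → ℝ} (hb : Tendsto (fun n => b n / √(Real.log n)) atTop atTop) :
    ∀ᶠ n : ℕ in atTop, K * ((√(a * n * Real.log n) + 1) / n) ≤ b n / √n := by
  filter_upwards [tendsto_log_natCast_atTop.eventually_ge_atTop 1,
    hb.eventually_ge_atTop (K * (√a + 1))] with n hlog hn
  rw [le_div_iff₀ (by positivity)] at hn
  calc K * ((√(a * n * Real.log n) + 1) / n)
      ≤ K * ((√a + 1) * (√n * √(Real.log n)) / n) := by
        gcongr; exact sqrt_mul_mul_log_add_one_le ha hlog
    _ = K * (√a + 1) * √(Real.log n) * (√n / n) := by ring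
    _ = K * (√a + 1) * √(Real.log n) / √n := by rw [Real.sqrt_div_self, ← div_eq_mul_inv]
    _ ≤ b n / √n := by gcongr

theorem exp_neg_sqrt_mul_log_sq_div {c : ℝ} (hc : 0 ≤ c) {n : ℕ} (hn : n ≠ 0) :
    Real.exp (-√(2 * c * n * Real.log n) ^ 2 / (2 * n)) = (n : ℝ) ^ (-c) := by
  have hn0 : (0 : ℝ) < n := by positivity
  rw [Real.sq_sqrt (mul_nonneg (by positivity) (Real.log_natCast_nonneg n)),
    Real.rpow_def_of_pos hn0]
  congr 1
  field_simp

theorem eventually_mul_exp_le_rpow_neg (d : ℕ) {c : ℝ} (hc : 0 ≤ c) : ∀ᶠ n : ℕ in atTop,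
    2 * (n * d + n * n + d * d) * Real.exp (-√(2 * (c + 3) * n * Real.log n) ^ 2 / (2 * n)) ≤
      (n : ℝ) ^ (-c) := by
  filter_upwards [eventually_ge_atTop (2 * (d + 1 + d * d)), eventually_gt_atTop 0] with n hnd hn
  have hn1 : (1 : ℝ) ≤ n := by exact_mod_cast hn
  have hnd' : (2 * (d + 1 + d * d) : ℝ) ≤ n := by exact_mod_cast hnd
  rw [exp_neg_sqrt_mul_log_sq_div (by positivity) hn.ne']
  calc 2 * (n * d + n * n + d * d) * (n : ℝ) ^ (-(c + 3))
      ≤ 2 * (n ^ 2 * d + n ^ 2 + n ^ 2 * (d * d)) * (n : ℝ) ^ (-(c + 3)) := by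
        gcongr ?_ * _
        nlinarith [mul_nonneg (sub_nonneg.2 hn1) (Nat.cast_nonneg (α := ℝ) d),
          mul_nonneg (sub_nonneg.2 hn1) (mul_self_nonneg (d : ℝ))]
    _ = n ^ 2 * (2 * (d + 1 + d * d)) * (n : ℝ) ^ (-(c + 3)) := by ring
    _ ≤ n ^ 2 * n * (n : ℝ) ^ (-(c + 3)) := by gcongr
    _ = (n : ℝ) ^ (-c) := by
        rw [← pow_succ, ← Real.rpow_natCast, ← Real.rpow_add (by positivity)]
        norm_num

theorem tendsto_log_sq_div_sqrt_log :
    Tendsto (fun n : ℕ => Real.log n ^ 2 / √(Real.log n)) atTop atTop := by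
  refine tendsto_atTop_mono' _ ?_ tendsto_log_natCast_atTop
  filter_upwards [tendsto_log_natCast_atTop.eventually_ge_atTop 1] with n hn
  rw [le_div_iff₀ (by positivity), sq]
  gcongr
  exact Real.sqrt_le_iff.2 ⟨by positivity, le_self_pow₀ hn two_ne_zero⟩

end Asymptotics

theorem IsRDPG.one_sub_le_measureReal_of_isConcentrated_imp {d n : ℕ} {Ω : Type*}
    [MeasurableSpace Ω] {F : Measure (EuclideanSpace ℝ (Fin d))} {μ : Measure Ω}
    [IsProbabilityMeasure μ] {X : Fin n → Ω → EuclideanSpace ℝ (Fin d)}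
    {A : Ω → Matrix (Fin n) (Fin n) ℝ} (h : IsRDPG F μ X A) (hF : IsLatentDistribution F) {t : ℝ}
    (ht : 0 ≤ t) {S : Set Ω}
    (hS : ∀ ω, IsConcentrated (secondMoment F) t (A ω) (positionMatrix X ω) → ω ∈ S) :
    1 - 2 * (n * d + n * n + d * d) * Real.exp (-t ^ 2 / (2 * n)) ≤ μ.real S := by
  have hcover : S ∪ {ω | ¬ IsConcentrated (secondMoment F) t (A ω) (positionMatrix X ω)} =
      Set.univ :=
    Set.eq_univ_of_forall fun ω => or_iff_not_imp_right.2 fun hω => hS ω (not_not.1 hω)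
  have hle := measureReal_union_le (μ := μ) S
    {ω | ¬ IsConcentrated (secondMoment F) t (A ω) (positionMatrix X ω)}
  rw [hcover, probReal_univ] at hle
  linarith [h.measureReal_not_isConcentrated_le hF ht]

open Filter in
theorem theorem1_general {d : ℕ} {F : Measure (EuclideanSpace ℝ (Fin d))}
    (hF : IsLatentDistribution F) (hrank : (secondMoment F).rank = d) {b : ℕ → ℝ}
    (hb : Tendsto (fun n => b n / √(Real.log n)) atTop atTop) {Ω : ℕ → Type*}
    [∀ n, MeasurableSpace (Ω n)] {μ : ∀ n, Measure (Ω n)} [∀ n, IsProbabilityMeasure (μ n)]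
    {X : ∀ n, Fin n → Ω n → EuclideanSpace ℝ (Fin d)} {A : ∀ n, Ω n → Matrix (Fin n) (Fin n) ℝ}
    (h : ∀ n, IsRDPG F (μ n) (X n) (A n)) :
    OccursAAS μ fun n =>
      {ω | ∀ Xhat : Matrix (Fin n) (Fin d) ℝ, IsASE d (A n ω) Xhat →
        ∃ W ∈ Matrix.orthogonalGroup (Fin d) ℝ,
          twoToInftyNorm (Xhat - positionMatrix (X n) ω * W) ≤ √(d : ℝ) * b n / √(n : ℝ)} := by
  intro c hc
  obtain ⟨κ, hκ, hκ1, hΔ⟩ := hF.exists_mul_norm_sq_le_inner_secondMoment hrank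
  have hc3 : 0 ≤ 2 * (c + 3) := by positivity
  refine (eventually_atTop.1 ?_).imp fun n₀ hn₀ n hn => hn₀ n hn.le
  filter_upwards [eventually_mul_exp_le_rpow_neg d hc.le, eventually_gt_atTop 0,
    eventually_mul_sqrt_mul_log_add_one_le (K := 16 * (d + 1) / κ ^ 3) hc3 (by positivity),
    eventually_mul_sqrt_mul_log_add_one_div_le (K := 5 / κ ^ 3) hc3 (by positivity) hb]
    with n htail hn hlarge hrate η hη _
  have := NeZero.of_pos hn
  rw [div_mul_eq_mul_div, div_le_iff₀' (by positivity)] at hlarge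
  refine (sub_le_sub_left (htail.trans hη.le) 1).trans <|
    (h n).one_sub_le_measureReal_of_isConcentrated_imp hF (Real.sqrt_nonneg _)
      fun ω hω Xhat hXhat => ?_
  obtain ⟨W, hW, hle⟩ := hω.exists_orthogonal_twoToInftyNorm_le (Real.sqrt_nonneg _) hκ hκ1 hΔ
    hlarge hXhat
  refine ⟨W, hW, hle.trans ?_⟩
  rw [mul_div_assoc, mul_left_comm, mul_div_assoc]
  gcongr

theorem theorem1 :
    ∃ C : ℝ, 0 < C ∧
      ∀ (d : ℕ) (F : Measure (EuclideanSpace ℝ (Fin d))), IsLatentDistribution F →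
        (secondMoment F).rank = d →
      ∀ (Ω : ℕ → Type*) [∀ n, MeasurableSpace (Ω n)] (μ : ∀ n, Measure (Ω n))
        [∀ n, IsProbabilityMeasure (μ n)]
        (X : ∀ n, Fin n → Ω n → EuclideanSpace ℝ (Fin d))
        (A : ∀ n, Ω n → Matrix (Fin n) (Fin n) ℝ),
        (∀ n, IsRDPG F (μ n) (X n) (A n)) →
        OccursAAS μ fun n =>
          {ω | ∀ Xhat : Matrix (Fin n) (Fin d) ℝ, IsASE d (A n ω) Xhat →
            ∃ W ∈ Matrix.orthogonalGroup (Fin d) ℝ,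
              twoToInftyNorm (Xhat - positionMatrix (X n) ω * W) ≤
                C * √(d : ℝ) * Real.log n ^ 2 / √(n : ℝ)} := by
  refine ⟨1, one_pos, fun d F hF hrank Ω _ μ _ X A h => ?_⟩
  simpa only [one_mul] using theorem1_general hF hrank tendsto_log_sq_div_sqrt_log h
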